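/- **Theorem (Recursive PAC-Bayes bound).** *Setting.* Let $\mathcal X,\mathcal Y$ be measurable spaces, $\mathcal D$ a probability distribution on $\mathcal X\times\mathcal Y$, and $\mathcal H$ a measurable space of prediction rules $h:\mathcal X\to\mathcal Y$ such that $\{(h,x,y): h(x)\ne y\}$ is measurable. Let $\ell(h(x),y)=\mathbf 1[h(x)\neq y]$ and $L(h)=\mathbb E_{(X,Y)\sim\mathcal D}[\ell(h(X),Y)]$; $\mathbb E_\rho[\cdot]$ stands for $\mathbb E_{h\sim\rho}[\cdot]$. For $p,q\in[0,1]$ let $\mathrm{kl}(p\|q)=\mathrm{KL}((1-p,p)\|(1-q,q))$ and, for $\hat p\in[0,1]$ and $\varepsilon\in[0,\infty]$, let $\mathrm{kl}^{-1,+}(\hat p,\varepsilon)=\max\{p\in[0,1]:\mathrm{kl}(\hat p\|p)\le\varepsilon\}$. *Data.* Let $S=\{(X_1,Y_1),\dots,(X_n,Y_n)\}$ be an i.i.d. sample from $\mathcal D$, split in an arbitrary data-independent way into $T\ge1$ disjoint subsamples, $S=S_1\cup\dots\cup S_T$, with $S_T\neq\emptyset$. Let $U^{\mathrm{train}}_t=\bigcup_{s=1}^tS_s$,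 $U^{\mathrm{val}}_t=\bigcup_{s=t}^TS_s$, $n^{\mathrm{val}}_t=|U^{\mathrm{val}}_t|$, and $\hat L(h,S)=\frac1n\sum_{i=1}^n\ell(h(X_i),Y_i)$. *Priors and coefficients.* Let $\pi_0^*,\dots,\pi_T^*$ be probability distributions on $\mathcal H$, where $\pi_t^*$ may depend (measurably) on $U^{\mathrm{train}}_t$ but not on the rest of the data. For $1\le t<T$ let $\hat\pi_t^*=(h_{t,1},\dots,h_{t,n})$ be auxiliary rules, one for each data point, which conditionally on $S$ and on the previously sampled $\hat\pi_1^*,\dots,\hat\pi_{t-1}^*$ are i.i.d. from $\pi_t^*$. Let $\gamma_2,\dots,\gamma_T\in[0,1]$, where $\gamma_t$ may depend (measurably) on $U^{\mathrm{train}}_{t-1}$ but not on the rest of the data. In addition, $\pi_t^*$ is allowed to depend on the previously sampled $\hat\pi_1^*,\dots,\hat\pi_{t-1}^*$, and $\gamma_t$ on $\hat\pi_1^*,\dots,\hat\pi_{t-2}^*$. For $1\le t\le T$ let $\mathcal P_t$ be a set of probability distributions on $\mathcal H$, which may depend on the data and on the auxiliary rules in an arbitrary way (in particular, on $U^{\mathrm{train}}_t$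 only). *Bounds.* For $t\ge2$ let $(b_{t|0},b_{t|1},b_{t|2},b_{t|3})=(-\gamma_t,0,1-\gamma_t,1)$ and, for $j\in\{1,2,3\}$, $$\hat F_{\gamma_t|j}(h,U^{\mathrm{val}}_t,\hat\pi^*_{t-1})=\frac1{n^{\mathrm{val}}_t}\sum_{i:(X_i,Y_i)\in U^{\mathrm{val}}_t}\mathbf 1\big[\ell(h(X_i),Y_i)-\gamma_t\,\ell(h_{t-1,i}(X_i),Y_i)\ge b_{t|j}\big].$$ For $\delta\in(0,1)$ define $$B_1(\pi_1)=\mathrm{kl}^{-1,+}\Big(\mathbb E_{\pi_1}[\hat L(h,S)],\ \frac{\mathrm{KL}(\pi_1\|\pi_0^*)+\ln\frac{2T\sqrt n}{\delta}}{n}\Big)$$ and, for $2\le t\le T$, $$\mathcal E_t(\pi_t,\gamma_t)=-\gamma_t+\sum_{j=1}^3(b_{t|j}-b_{t|j-1})\,\mathrm{kl}^{-1,+}\Big(\mathbb E_{\pi_t}[\hat F_{\gamma_t|j}(h,U^{\mathrm{val}}_t,\hat\pi_{t-1}^*)],\ \frac{\mathrm{KL}(\pi_t\|\pi_{t-1}^*)+\ln\frac{6T\sqrt{n^{\mathrm{val}}_t}}{\delta}}{n^{\mathrm{val}}_t}\Big),$$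 $$B_t(\pi_t)=\mathcal E_t(\pi_t,\gamma_t)+\gamma_t\,B_{t-1}(\pi_{t-1}^*).$$ *Conclusion.* For every $\delta\in(0,1)$, with probability at least $1-\delta$ over the sample and the auxiliary rules, simultaneously for all $t\in\{1,\dots,T\}$ and all $\pi_t\in\mathcal P_t$, $$\mathbb E_{\pi_t}[L(h)]<B_t(\pi_t)\quad\text{or}\quad \mathbb E_{\pi_t}[L(h)]=B_t(\pi_t)=1;$$ that is, the event that this fails for some $t$ and some $\pi_t\in\mathcal P_t$ has (outer) probability at most $\delta$. -/

import Mathlib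

open MeasureTheory ProbabilityTheory Set
open scoped ENNReal

noncomputable section

namespace RPB

/-- The binary divergence `kl(p‖q) = KL((1-p, p) ‖ (1-q, q))` for `p, q ∈ [0,1]`, with value `∞` when
`(1-p, p)` is not absolutely continuous with respect to `(1-q, q)`. -/
def kl (p q : ℝ) : ℝ≥0∞ :=
  open scoped Classical in
  if (q = 0 ∧ p ≠ 0) ∨ (q = 1 ∧ p ≠ 1) then ∞
  else ENNReal.ofReal (p * Real.log (p / q) + (1 - p) * Real.log ((1 - p) / (1 - q)))

/-- The upper inverse `kl^{-1,+}(p̂, ε) = max {p ∈ [0,1] : kl(p̂‖p) ≤ ε}`; `ε` may be infinite. -/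
def klInvUpper (phat : ℝ) (ε : ℝ≥0∞) : ℝ :=
  sSup {p : ℝ | p ∈ Icc (0 : ℝ) 1 ∧ kl phat p ≤ ε}

section Loss

variable {X Y H : Type*}

/-- The zero-one loss `ℓ(h(x), y)`, where `predict h : X → Y` is the prediction rule `h`. -/
def loss (predict : H → X → Y) (h : H) (z : X × Y) : ℝ :=
  open scoped Classical in if predict h z.1 ≠ z.2 then 1 else 0

/-- The expected loss `L(h)`. -/
def risk [MeasurableSpace X] [MeasurableSpace Y] (predict : H → X → Y) (D : Measure (X × Y))
    (h : H) : ℝ :=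
  ∫ z, loss predict h z ∂D

/-- The empirical loss `L̂(h, S)` on the whole sample. -/
def empRisk (predict : H → X → Y) {n : ℕ} (z : Fin n → X × Y) (h : H) : ℝ :=
  (1 / (n : ℝ)) * ∑ i, loss predict h (z i)

/-- The points `b_{t|0}, …, b_{t|3}`, that is `-γ, 0, 1-γ, 1`. -/
def bpt (γ : ℝ) : Fin 4 → ℝ := ![-γ, 0, 1 - γ, 1]

/-- The binary component `f_{γ|j}(h, (x, y, h')) = 𝟙[ℓ(h(x), y) - γ ℓ(h'(x), y) ≥ b_j]`. -/
def splitLoss (predict : H → X → Y) (γ : ℝ) (j : Fin 4) (h : H) (z : X × Y) (h' : H) : ℝ :=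
  open scoped Classical in
  if bpt γ j ≤ loss predict h z - γ * loss predict h' z then 1 else 0

/-- The indices of the validation set `U^val_t = S_t ∪ … ∪ S_T`; the `i`-th point belongs to the
subsample `S_{chunk i}`. -/
def valIdx {n : ℕ} (chunk : Fin n → ℕ) (t : ℕ) : Finset (Fin n) :=
  Finset.univ.filter fun i => t ≤ chunk i

/-- The size `n^val_t` of the validation set. -/
def nVal {n : ℕ} (chunk : Fin n → ℕ) (t : ℕ) : ℕ := (valIdx chunk t).card

/-- The empirical mean `F̂_{γ|j}(h, U^val_t, ĥ)`, the rule `hs i` being paired with the point `z i`. -/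
def empSplit (predict : H → X → Y) {n : ℕ} (chunk : Fin n → ℕ) (z : Fin n → X × Y)
    (hs : Fin n → H) (t : ℕ) (γ : ℝ) (j : Fin 4) (h : H) : ℝ :=
  (1 / (nVal chunk t : ℝ)) * ∑ i ∈ valIdx chunk t, splitLoss predict γ j h (z i) (hs i)

variable [MeasurableSpace H]

/-- The bound `B_1(ρ)`, with prior `π0`. -/
def firstBound (predict : H → X → Y) {n : ℕ} (T : ℕ) (δ : ℝ) (z : Fin n → X × Y)
    (π0 ρ : Measure H) : ℝ :=
  klInvUpper (∫ h, empRisk predict z h ∂ρ)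
    ((InformationTheory.klDiv ρ π0 + ENNReal.ofReal (Real.log (2 * T * √(n : ℝ) / δ))) / (n : ℝ≥0∞))

/-- The excess loss bound `𝓔_t(ρ, γ)`, with prior `π` (the distribution `π*_{t-1}`) and rules `hs`
sampled from `π`. -/
def excessBound (predict : H → X → Y) {n : ℕ} (T : ℕ) (δ : ℝ) (chunk : Fin n → ℕ)
    (z : Fin n → X × Y) (hs : Fin n → H) (t : ℕ) (γ : ℝ) (π ρ : Measure H) : ℝ :=
  -γ + ∑ j : Fin 3, (bpt γ j.succ - bpt γ j.castSucc) *
    klInvUpper (∫ h, empSplit predict chunk z hs t γ j.succ h ∂ρ)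
      ((InformationTheory.klDiv ρ π
          + ENNReal.ofReal (Real.log (6 * T * √(nVal chunk t : ℝ) / δ))) / (nVal chunk t : ℝ≥0∞))

/-- The recursive bound `B_t(ρ)`, for `t ≥ 1` (the value at `t = 0` is irrelevant):
`B_t(ρ) = 𝓔_t(ρ, γ_t) + γ_t B_{t-1}(π*_{t-1})` for `t ≥ 2`. Here `hs s` is the sequence of rules
sampled from `πs s = π*_s`. -/
def bound (predict : H → X → Y) {n : ℕ} (T : ℕ) (δ : ℝ) (chunk : Fin n → ℕ)
    (z : Fin n → X × Y) (hs : ℕ → Fin n → H) (γ : ℕ → ℝ) (πs : ℕ → Measure H) :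
    ℕ → Measure H → ℝ
  | 0, _ => 0
  | 1, ρ => firstBound predict T δ z (πs 0) ρ
  | t + 2, ρ =>
      excessBound predict T δ chunk z (hs (t + 1)) (t + 2) (γ (t + 2)) (πs (t + 1)) ρ
        + γ (t + 2) * bound predict T δ chunk z hs γ πs (t + 1) (πs (t + 1))

end Loss

section Information

variable {Ω Z H : Type*} [MeasurableSpace Z] [MeasurableSpace H]

/-- The σ-algebra generated by the rules `hs s i` with `1 ≤ s < t`. -/
abbrev rulesInfo {n : ℕ} (hs : ℕ → Fin n → Ω → H) (t : ℕ) : MeasurableSpace Ω :=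
  ⨆ s ∈ Finset.Ico 1 t, ⨆ i, MeasurableSpace.comap (hs s i) inferInstance

/-- The σ-algebra generated by `U^train_t = S_1 ∪ … ∪ S_t` and by the rules `hs s i` with
`1 ≤ s < t`, that is, by all that has been drawn when `π*_t` is constructed. -/
abbrev trainInfo {n : ℕ} (chunk : Fin n → ℕ) (S : Fin n → Ω → Z) (hs : ℕ → Fin n → Ω → H) (t : ℕ) :
    MeasurableSpace Ω :=
  (⨆ i, ⨆ (_ : chunk i ≤ t), MeasurableSpace.comap (S i) inferInstance) ⊔ rulesInfo hs t

/-- The σ-algebra generated by the whole sample and by the rules `hs s i` with `1 ≤ s < t`. -/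
abbrev fullInfo {n : ℕ} (S : Fin n → Ω → Z) (hs : ℕ → Fin n → Ω → H) (t : ℕ) : MeasurableSpace Ω :=
  (⨆ i, MeasurableSpace.comap (S i) inferInstance) ⊔ rulesInfo hs t

/-- Conditionally on the σ-algebra `m`, the random elements `g i` are independent, each with
distribution `π`, where the distribution `π ω` is random. -/
def CondIIDFrom [MeasurableSpace Ω] (μ : Measure Ω) (m : MeasurableSpace Ω) {n : ℕ}
    (π : Ω → Measure H) (g : Fin n → Ω → H) : Prop :=
  ∀ A : Set Ω, MeasurableSet[m] A → ∀ B : Fin n → Set H, (∀ i, MeasurableSet (B i)) →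
    μ (A ∩ {ω | ∀ i, g i ω ∈ B i}) = ∫⁻ ω in A, ∏ i, π ω (B i) ∂μ

end Information

end RPB

end

/-!
The bound `B_t` follows by a union bound from `1 + 3 (T - 1)` instances of the PAC-Bayes-kl
inequality, one for the empirical loss on the whole sample and three for each step `t ≥ 2`.

*The PAC-Bayes-kl inequality* (`pacBayes_kl`). Let `p̂(h)` be the frequency of a binary loss over
`m` observations and `p(h)` its mean. For a fixed `h`, `E exp (m kl(p̂(h)‖p(h)))` is at most
`∑ k, C(m, k) (k/m)^k (1 - k/m)^(m-k)`, which is at most `2 √m`: by Stirling's formula each term is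
at most `2 √m` times `C(2k, k) C(2(m-k), m-k) / 4^m`, and these numbers sum up to `1`
(`sum_choose_mul_pow_mul_pow_le`). By Fubini's theorem the expected `π`-average of the exponentials
is at most `2 √m` too, so that by Markov's inequality it is less than `2 √m / c` outside an event of
probability at most `c`. There the Donsker–Varadhan inequality (`lintegral_lt_klDiv_add_log`) and
Jensen's inequality (`kl_integral_le`) give `m kl(E_ρ p̂ ‖ E_ρ p) < KL(ρ‖π) + log (2 √m / c)` for
all `ρ` with a finite divergence from `π`. No measurability in `ρ` is needed, since the exceptional
event does not depend on `ρ`.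

*Random priors.* At step `t` the prior `π*_{t-1}` and the coefficient `γ_t` are random, but they are
functions of the training information, and conditionally on it the pairs of a validation point and a
rule drawn for it are i.i.d. from `D ⊗ π*_{t-1}` (`CondIIDFrom.measure_inter_box`). The point at
issue is that the earlier rules, drawn for all the data, reveal nothing about the validation data:
they are drawn from distributions that depend only on the training data and on rules drawn before
them, and independence is preserved by each such draw (`CondIIDFrom.indep_sup`,
`indep_dataInfo_trainInfo`).

*The recursion.* The excess loss `ℓ(h) - γ ℓ(h')` is `-γ` plus a combination of three binary losses
with nonnegative coefficients, hence `E_ρ L` is `-γ` plus a combination of their means and of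
`E_{π*_{t-1}} L` (`integral_risk_eq`). Each of these quantities is less than its bound, or both are
`1`; this passes to the combination (`LtOrOne.recursion`), because for `γ > 0` the third mean and the
reference risk cannot both be `1`.
-/

namespace RPB

/-! ### The moment bound for the binomial distribution -/

open Finset.HasAntidiagonal (antidiagonal)

/-- The convolution of the central binomial coefficients, by the recurrence
`(k + 1) C(2k + 2, k + 1) = 2 (2k + 1) C(2k, k)` and the symmetry of the sum. -/
theorem sum_antidiagonal_centralBinom (n : ℕ) :
    ∑ p ∈ antidiagonal n, p.1.centralBinom * p.2.centralBinom = 4 ^ n := by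
  induction n with
  | zero => simp
  | succ n ih =>
    set c := Nat.centralBinom with hc
    have hsymm : ∀ m : ℕ, 2 * ∑ p ∈ antidiagonal m, p.1 * (c p.1 * c p.2)
        = m * ∑ p ∈ antidiagonal m, c p.1 * c p.2 := by
      intro m
      have h1 : ∑ p ∈ antidiagonal m, p.1 * (c p.1 * c p.2)
          = ∑ p ∈ antidiagonal m, p.2 * (c p.1 * c p.2) := by
        rw [← Finset.Nat.sum_antidiagonal_swap]
        exact Finset.sum_congr rfl fun p _ => by simp [mul_comm (c p.2)]
      calc _ = ∑ p ∈ antidiagonal m, p.1 * (c p.1 * c p.2)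
            + ∑ p ∈ antidiagonal m, p.2 * (c p.1 * c p.2) := by rw [← h1]; ring
        _ = _ := by
          rw [← Finset.sum_add_distrib, Finset.mul_sum]
          refine Finset.sum_congr rfl fun p hp => ?_
          rw [← Finset.HasAntidiagonal.mem_antidiagonal.1 hp]; ring
    have hrec : ∑ p ∈ antidiagonal (n + 1), p.1 * (c p.1 * c p.2)
        = 2 * (2 * ∑ p ∈ antidiagonal n, p.1 * (c p.1 * c p.2)) + 2 * 4 ^ n := by
      rw [Finset.Nat.sum_antidiagonal_succ, ← ih]
      simp only [Finset.mul_sum, ← Finset.sum_add_distrib, zero_mul, zero_add]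
      refine Finset.sum_congr rfl fun p _ => ?_
      have := Nat.succ_mul_centralBinom_succ p.1
      rw [← hc] at this
      rw [← mul_assoc, this]; ring
    have h1 := hsymm (n + 1)
    rw [hrec, hsymm n, ih] at h1
    have : (n + 1) * ∑ p ∈ antidiagonal (n + 1), c p.1 * c p.2 = (n + 1) * 4 ^ (n + 1) := by
      rw [← h1]; ring
    exact Nat.eq_of_mul_eq_mul_left (Nat.succ_pos n) this

theorem four_pow_le_two_mul_sqrt_mul_centralBinom {n : ℕ} (hn : n ≠ 0) :
    (4 : ℝ) ^ n ≤ 2 * √n * n.centralBinom := by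
  have key : ∀ k : ℕ,
      ((4 : ℝ) ^ (k + 1)) ^ 2 ≤ 4 * (k + 1) * (((k + 1).centralBinom : ℕ) : ℝ) ^ 2 := by
    intro k
    induction k with
    | zero => norm_num [Nat.centralBinom, Nat.choose]
    | succ k ih =>
      have h : ((k + 1 : ℕ) + 1 : ℝ) * ((k + 1 + 1).centralBinom : ℕ)
          = 2 * (2 * (k + 1 : ℕ) + 1) * ((k + 1).centralBinom : ℕ) := by
        exact_mod_cast Nat.succ_mul_centralBinom_succ (k + 1)
      push_cast at h ⊢
      set x : ℝ := (((k + 1).centralBinom : ℕ) : ℝ)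
      set y : ℝ := (((k + 1 + 1).centralBinom : ℕ) : ℝ)
      have hy : ((k : ℝ) + 1 + 1) * (4 * (k + 1 + 1) * y ^ 2)
          = 16 * (2 * (k + 1) + 1) ^ 2 * x ^ 2 := by
        calc _ = 4 * ((k + 1 + 1) * y) ^ 2 := by ring
          _ = _ := by rw [h]; ring
      have hk : (0 : ℝ) < k + 1 + 1 := by positivity
      refine le_of_mul_le_mul_left ?_ hk
      rw [hy]
      calc ((k : ℝ) + 1 + 1) * (4 ^ (k + 1 + 1)) ^ 2
            = 16 * (k + 1 + 1) * (4 ^ (k + 1)) ^ 2 := by ring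
        _ ≤ 16 * (k + 1 + 1) * (4 * (k + 1) * x ^ 2) := by gcongr
        _ ≤ _ := by nlinarith [sq_nonneg x]
  obtain ⟨k, rfl⟩ := Nat.exists_eq_succ_of_ne_zero hn
  refine (abs_le_of_sq_le_sq' ?_ (by positivity)).2
  rw [mul_pow, mul_pow, Real.sq_sqrt (by positivity)]
  have := key k
  simp only [Nat.succ_eq_add_one]
  push_cast
  linarith

theorem factorial_le_exp_mul_sqrt_mul {n : ℕ} (hn : n ≠ 0) :
    (n.factorial : ℝ) ≤ Real.exp 1 * √n * (n / Real.exp 1) ^ n := by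
  obtain ⟨k, rfl⟩ := Nat.exists_eq_succ_of_ne_zero hn
  have h := Stirling.stirlingSeq'_antitone (Nat.zero_le k)
  simp only [Function.comp, Nat.succ_eq_add_one, zero_add, Stirling.stirlingSeq_one] at h
  rw [Stirling.stirlingSeq, div_le_div_iff₀ (by positivity) (by positivity)] at h
  have h2 : √(2 * ((k + 1 : ℕ) : ℝ)) = √2 * √((k + 1 : ℕ) : ℝ) := Real.sqrt_mul (by norm_num) _
  rw [h2] at h
  have h3 : (0 : ℝ) < √2 := by positivity
  refine le_of_mul_le_mul_right (h.trans_eq ?_) h3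
  rw [Nat.succ_eq_add_one]
  ring

/-- The Krichevsky–Trofimov inequality: the maximal probability of `a` successes and `b` failures in
Bernoulli trials is at most `2√(a + b)` times their probability `C(2a, a) C(2b, b) / 4 ^ (a + b)`
when the success probability has the arcsine law. -/
theorem choose_mul_pow_mul_pow_le {a b : ℕ} (hab : a + b ≠ 0) :
    ((a + b).choose a : ℝ) * ((a : ℝ) / (a + b : ℕ)) ^ a * ((b : ℝ) / (a + b : ℕ)) ^ b
      ≤ 2 * √(a + b : ℕ) * (a.centralBinom * b.centralBinom / 4 ^ (a + b)) := by
  rcases Nat.eq_zero_or_pos a with rfl | ha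
  · have := four_pow_le_two_mul_sqrt_mul_centralBinom hab
    simp only [zero_add] at this hab ⊢
    have hb : (b : ℝ) ≠ 0 := by exact_mod_cast hab
    simp only [Nat.choose_zero_right, pow_zero, div_self hb, one_pow, Nat.centralBinom_zero]
    rw [← mul_div_assoc, le_div_iff₀ (by positivity)]
    simpa using this
  rcases Nat.eq_zero_or_pos b with rfl | hb
  · have := four_pow_le_two_mul_sqrt_mul_centralBinom hab
    simp only [add_zero] at this hab ⊢
    have ha : (a : ℝ) ≠ 0 := by exact_mod_cast hab
    simp only [Nat.choose_self, pow_zero, div_self ha, one_pow, Nat.centralBinom_zero]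
    rw [← mul_div_assoc, le_div_iff₀ (by positivity)]
    simpa using this
  set n := a + b with hn
  have hchoose : (n.choose a : ℝ) * (a.factorial * b.factorial) = n.factorial := by
    have := Nat.choose_mul_factorial_mul_factorial (hn ▸ Nat.le_add_right a b : a ≤ n)
    rw [hn, Nat.add_sub_cancel_left, ← hn] at this
    rw [← mul_assoc]; exact_mod_cast this
  have hnf := factorial_le_exp_mul_sqrt_mul hab
  have haf := Stirling.le_factorial_stirling a
  have hbf := Stirling.le_factorial_stirling b
  have hac := four_pow_le_two_mul_sqrt_mul_centralBinom ha.ne'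
  have hbc := four_pow_le_two_mul_sqrt_mul_centralBinom hb.ne'
  have ha' : (0 : ℝ) < a := by exact_mod_cast ha
  have hb' : (0 : ℝ) < b := by exact_mod_cast hb
  have hn' : (0 : ℝ) < n := by exact_mod_cast Nat.pos_of_ne_zero hab
  have he := Real.exp_pos 1
  have h1 : (n.choose a : ℝ) * ((a : ℝ) / n) ^ a * ((b : ℝ) / n) ^ b * (2 * Real.pi * (√a * √b))
      ≤ Real.exp 1 * √n := by
    have h2 : (n.choose a : ℝ) * ((√(2 * Real.pi * a) * (a / Real.exp 1) ^ a)
        * (√(2 * Real.pi * b) * (b / Real.exp 1) ^ b))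
        ≤ Real.exp 1 * √n * (n / Real.exp 1) ^ n := by
      refine le_trans ?_ hnf
      rw [← hchoose]
      gcongr
    have h3 : √(2 * Real.pi * a) * √(2 * Real.pi * b) = 2 * Real.pi * (√a * √b) := by
      rw [Real.sqrt_mul (by positivity), Real.sqrt_mul (by positivity : 0 ≤ 2 * Real.pi)]
      have := Real.mul_self_sqrt (by positivity : 0 ≤ 2 * Real.pi)
      linear_combination (√a * √b) * this
    have h4 : (n / Real.exp 1) ^ n * (((a : ℝ) / n) ^ a * ((b : ℝ) / n) ^ b)
        = (a / Real.exp 1) ^ a * (b / Real.exp 1) ^ b := by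
      rw [show ((n : ℝ) / Real.exp 1) ^ n = (n / Real.exp 1) ^ a * (n / Real.exp 1) ^ b by
        rw [← pow_add]]
      rw [mul_mul_mul_comm, ← mul_pow, ← mul_pow]
      congr 2 <;> field_simp
    have h5 : 0 < ((n : ℝ) / Real.exp 1) ^ n := by positivity
    refine le_of_mul_le_mul_right ?_ h5
    refine le_trans (le_of_eq ?_) h2
    linear_combination (n.choose a : ℝ) * (2 * Real.pi * (√a * √b)) * h4
      - (n.choose a : ℝ) * (a / Real.exp 1) ^ a * (b / Real.exp 1) ^ b * h3
  -- As `e ≤ π`, the left-hand side is at most `√n / (2 √a √b)`.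
  have h6 : (n.choose a : ℝ) * ((a : ℝ) / n) ^ a * ((b : ℝ) / n) ^ b ≤ √n / (2 * (√a * √b)) := by
    rw [le_div_iff₀ (by positivity)]
    have hpi : Real.exp 1 ≤ Real.pi :=
      (Real.exp_one_lt_d9.trans (lt_trans (by norm_num) Real.pi_gt_three)).le
    refine le_of_mul_le_mul_right ?_ Real.pi_pos
    calc _ = (n.choose a : ℝ) * ((a : ℝ) / n) ^ a * ((b : ℝ) / n) ^ b
          * (2 * Real.pi * (√a * √b)) := by ring
      _ ≤ _ := h1
      _ ≤ √n * Real.pi := by rw [mul_comm]; gcongr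
  refine h6.trans ?_
  rw [div_le_iff₀ (by positivity)]
  have h7 : (4 : ℝ) ^ n ≤ (2 * √a * a.centralBinom) * (2 * √b * b.centralBinom) := by
    rw [hn, pow_add]; gcongr
  have h8 : 1 ≤ (2 * √a * a.centralBinom) * (2 * √b * b.centralBinom) / 4 ^ n := by
    rwa [le_div_iff₀ (by positivity), one_mul]
  calc √n = √n * 1 := (mul_one _).symm
    _ ≤ √n * ((2 * √a * a.centralBinom) * (2 * √b * b.centralBinom) / 4 ^ n) := by gcongr
    _ = _ := by ring

/-- Maurer's bound. The sum is the value of `E exp (n kl(p̂‖p))` for the frequency `p̂` of successes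
in `n` Bernoulli trials, for every `p` in `(0, 1)`. -/
theorem sum_choose_mul_pow_mul_pow_le {n : ℕ} (hn : n ≠ 0) :
    ∑ k ∈ Finset.range (n + 1), (n.choose k : ℝ) * ((k : ℝ) / n) ^ k * (1 - (k : ℝ) / n) ^ (n - k)
      ≤ 2 * √n := by
  have hn' : (n : ℝ) ≠ 0 := by exact_mod_cast hn
  rw [← Finset.Nat.sum_antidiagonal_eq_sum_range_succ
    (fun a b => (n.choose a : ℝ) * ((a : ℝ) / n) ^ a * (1 - (a : ℝ) / n) ^ b)]
  calc _ ≤ ∑ p ∈ antidiagonal n,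
        2 * √n * ((p.1.centralBinom * p.2.centralBinom : ℕ) / 4 ^ n) := by
        refine Finset.sum_le_sum fun p hp => ?_
        have hp' := Finset.HasAntidiagonal.mem_antidiagonal.1 hp
        have h := choose_mul_pow_mul_pow_le (a := p.1) (b := p.2) (by rwa [hp'])
        have h1 : 1 - (p.1 : ℝ) / n = p.2 / n := by
          rw [eq_div_iff hn', sub_mul, div_mul_cancel₀ _ hn', ← hp']; push_cast; ring
        rw [hp'] at h
        rw [h1]; push_cast; exact h
    _ = 2 * √n := by
      rw [← Finset.mul_sum, ← Finset.sum_div, ← Nat.cast_sum, sum_antidiagonal_centralBinom]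
      simp

/-! ### The binary divergence and its upper inverse -/

theorem integral_mem_Icc {α : Type*} [MeasurableSpace α] (ν : Measure α)
    [IsProbabilityMeasure ν] {f : α → ℝ} (h01 : ∀ a, f a ∈ Icc (0 : ℝ) 1) :
    ∫ a, f a ∂ν ∈ Icc (0 : ℝ) 1 := by
  refine ⟨integral_nonneg fun a => (h01 a).1, ?_⟩
  have hle : ∀ a, ‖f a‖ ≤ 1 := fun a => by
    rw [Real.norm_of_nonneg (h01 a).1]; exact (h01 a).2
  have := norm_integral_le_of_norm_le_const (μ := ν) (ae_of_all _ hle)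
  simp only [probReal_univ, mul_one] at this
  exact (le_abs_self _).trans this

theorem measurable_kl : Measurable fun x : ℝ × ℝ => kl x.1 x.2 := by
  unfold kl
  refine Measurable.ite ?_ measurable_const ?_
  · have h1 : MeasurableSet {x : ℝ × ℝ | x.2 = 0} := measurable_snd (measurableSet_singleton 0)
    have h2 : MeasurableSet {x : ℝ × ℝ | x.1 = 0} := measurable_fst (measurableSet_singleton 0)
    have h3 : MeasurableSet {x : ℝ × ℝ | x.2 = 1} := measurable_snd (measurableSet_singleton 1)
    have h4 : MeasurableSet {x : ℝ × ℝ | x.1 = 1} := measurable_fst (measurableSet_singleton 1)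
    exact (h1.inter h2.compl).union (h3.inter h4.compl)
  · fun_prop

theorem kl_of_ac {p q : ℝ} (h0 : q = 0 → p = 0) (h1 : q = 1 → p = 1) :
    kl p q = ENNReal.ofReal (p * Real.log (p / q) + (1 - p) * Real.log ((1 - p) / (1 - q))) :=
  if_neg (by tauto)

theorem ac_of_kl_ne_top {p q : ℝ} (h : kl p q ≠ ∞) : (q = 0 → p = 0) ∧ (q = 1 → p = 1) := by
  by_contra hc
  exact h (if_pos (by tauto))

/-- The function `(x, y) ↦ x log (x / y)` lies above its tangent plane along the ray through
`(P, Q)`. -/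
theorem mul_log_div_ge_tangent {x y P Q : ℝ} (hx : 0 ≤ x) (hy : 0 ≤ y) (hyx : y = 0 → x = 0)
    (hP : 0 ≤ P) (hQ : 0 < Q) (hPx : P = 0 → x = 0) :
    x * Real.log (P / Q) + x - y * (P / Q) ≤ x * Real.log (x / y) := by
  rcases hx.eq_or_lt with rfl | hx'
  · have : 0 ≤ y * (P / Q) := by positivity
    simpa using this
  have hy' : 0 < y := hy.lt_of_ne fun h => hx'.ne' (hyx h.symm)
  have hP' : 0 < P := hP.lt_of_ne fun h => hx'.ne' (hPx h.symm)
  have h := Real.log_le_sub_one_of_pos (x := (P / Q) / (x / y)) (by positivity)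
  rw [Real.log_div (by positivity) (by positivity)] at h
  have h2 := mul_le_mul_of_nonneg_left h hx
  have h3 : x * ((P / Q) / (x / y)) = y * (P / Q) := by field_simp
  rw [mul_sub, mul_sub, h3, mul_one] at h2
  linarith

theorem kl_real_nonneg {p q : ℝ} (hp : p ∈ Icc (0 : ℝ) 1) (hq : q ∈ Icc (0 : ℝ) 1)
    (h0 : q = 0 → p = 0) (h1 : q = 1 → p = 1) :
    0 ≤ p * Real.log (p / q) + (1 - p) * Real.log ((1 - p) / (1 - q)) := by
  have e1 : p - q ≤ p * Real.log (p / q) := by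
    simpa using mul_log_div_ge_tangent (P := 1) (Q := 1) hp.1 hq.1 h0 zero_le_one one_pos (by simp)
  have e2 : (1 - p) - (1 - q) ≤ (1 - p) * Real.log ((1 - p) / (1 - q)) := by
    simpa using mul_log_div_ge_tangent (x := 1 - p) (y := 1 - q) (P := 1) (Q := 1)
      (by linarith [hp.2]) (by linarith [hq.2]) (fun h => by linarith [h1 (by linarith)])
      zero_le_one one_pos (by simp)
  linarith

theorem eq_zero_ae_of_integral_eq_zero {H : Type*} [MeasurableSpace H] {ρ : Measure H}
    {a : H → ℝ} (ha0 : ∀ h, 0 ≤ a h) (hint : Integrable a ρ) (h : ∫ h, a h ∂ρ = 0) :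
    ∀ᵐ x ∂ρ, a x = 0 :=
  (integral_eq_zero_iff_of_nonneg ha0 hint).1 h

/-- Jensen's inequality for the jointly convex function `kl`. -/
theorem kl_integral_le {H : Type*} [MeasurableSpace H] (ρ : Measure H) [IsProbabilityMeasure ρ]
    {a b : H → ℝ} (ha : Measurable a) (hb : Measurable b) (ha01 : ∀ h, a h ∈ Icc (0 : ℝ) 1)
    (hb01 : ∀ h, b h ∈ Icc (0 : ℝ) 1) :
    kl (∫ h, a h ∂ρ) (∫ h, b h ∂ρ) ≤ ∫⁻ h, kl (a h) (b h) ∂ρ := by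
  by_cases htop : ∫⁻ h, kl (a h) (b h) ∂ρ = ∞
  · rw [htop]; exact le_top
  have hmeas : Measurable fun h => kl (a h) (b h) := measurable_kl.comp (ha.prodMk hb)
  have hfin : ∀ᵐ h ∂ρ, kl (a h) (b h) ≠ ∞ :=
    (ae_lt_top hmeas htop).mono fun h hh => hh.ne
  have haint : Integrable a ρ :=
    Integrable.of_mem_Icc 0 1 ha.aemeasurable (ae_of_all _ ha01)
  have hbint : Integrable b ρ :=
    Integrable.of_mem_Icc 0 1 hb.aemeasurable (ae_of_all _ hb01)
  set P := ∫ h, a h ∂ρ with hP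
  set Q := ∫ h, b h ∂ρ with hQ
  have hP1 : ∫ h, (1 - a h) ∂ρ = 1 - P := by
    rw [integral_sub (integrable_const _) haint]; simp [hP]
  have hQ1 : ∫ h, (1 - b h) ∂ρ = 1 - Q := by
    rw [integral_sub (integrable_const _) hbint]; simp [hQ]
  have hPmem : P ∈ Icc (0 : ℝ) 1 := integral_mem_Icc ρ ha01
  have hQmem : Q ∈ Icc (0 : ℝ) 1 := integral_mem_Icc ρ hb01
  have haint1 : Integrable (fun h => 1 - a h) ρ := (integrable_const _).sub haint
  have hbint1 : Integrable (fun h => 1 - b h) ρ := (integrable_const _).sub hbint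
  have hP0 : P = 0 → ∀ᵐ h ∂ρ, a h = 0 := fun h =>
    eq_zero_ae_of_integral_eq_zero (fun h => (ha01 h).1) haint h
  have hP1' : 1 - P = 0 → ∀ᵐ h ∂ρ, 1 - a h = 0 := fun h =>
    eq_zero_ae_of_integral_eq_zero (fun h => by linarith [(ha01 h).2]) haint1 (hP1.trans h)
  have hQ0 : Q = 0 → P = 0 := fun h => by
    have h1 := eq_zero_ae_of_integral_eq_zero (fun h => (hb01 h).1) hbint h
    have : a =ᵐ[ρ] fun _ => 0 := by
      filter_upwards [h1, hfin] with x hx1 hx2 using (ac_of_kl_ne_top hx2).1 hx1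
    rw [hP, integral_congr_ae this]; simp
  have hQ1' : Q = 1 → P = 1 := fun h => by
    have h1 := eq_zero_ae_of_integral_eq_zero (fun h => by linarith [(hb01 h).2]) hbint1
      (hQ1.trans (by linarith))
    have : a =ᵐ[ρ] fun _ => 1 := by
      filter_upwards [h1, hfin] with x hx1 hx2 using (ac_of_kl_ne_top hx2).2 (by linarith)
    rw [hP, integral_congr_ae this]; simp
  rw [kl_of_ac hQ0 hQ1']
  -- If `Q` is `0` or `1`, then so is `P`, and the divergence vanishes.
  rcases hQmem.1.eq_or_lt with hQz | hQpos
  · have hPz : P = 0 := hQ0 hQz.symm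
    rw [← hQz, hPz]; simp
  rcases hQmem.2.eq_or_lt with hQz | hQlt
  · have hPz : P = 1 := hQ1' hQz
    rw [hQz, hPz]; simp
  -- `T` is the tangent plane of `kl` at `(P, Q)`, evaluated at `(a h, b h)`.
  set T : H → ℝ := fun h => (a h * Real.log (P / Q) + a h - b h * (P / Q))
      + ((1 - a h) * Real.log ((1 - P) / (1 - Q)) + (1 - a h) - (1 - b h) * ((1 - P) / (1 - Q)))
    with hT
  have hA : Integrable (fun h => a h * Real.log (P / Q) + a h) ρ := (haint.mul_const _).add haint
  have hB : Integrable (fun h => b h * (P / Q)) ρ := hbint.mul_const _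
  have hA1 : Integrable (fun h => (1 - a h) * Real.log ((1 - P) / (1 - Q)) + (1 - a h)) ρ :=
    (haint1.mul_const _).add haint1
  have hB1 : Integrable (fun h => (1 - b h) * ((1 - P) / (1 - Q))) ρ := hbint1.mul_const _
  have hAB : Integrable (fun h => a h * Real.log (P / Q) + a h - b h * (P / Q)) ρ := hA.sub hB
  have hAB1 : Integrable (fun h => (1 - a h) * Real.log ((1 - P) / (1 - Q)) + (1 - a h)
      - (1 - b h) * ((1 - P) / (1 - Q))) ρ := hA1.sub hB1
  have hTint : Integrable T ρ := hAB.add hAB1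
  have hTI : ∫ h, T h ∂ρ = P * Real.log (P / Q) + (1 - P) * Real.log ((1 - P) / (1 - Q)) := by
    rw [hT, integral_add hAB hAB1, integral_sub hA hB, integral_sub hA1 hB1,
      integral_add (haint.mul_const _) haint, integral_add (haint1.mul_const _) haint1,
      integral_mul_const, integral_mul_const, integral_mul_const, integral_mul_const, hP1, hQ1,
      ← hP, ← hQ]
    have : 1 - Q ≠ 0 := by linarith
    field_simp
    ring
  rw [← hTI]
  have hle : ∀ᵐ h ∂ρ, ENNReal.ofReal (T h) ≤ kl (a h) (b h) := by
    have h1 : ∀ᵐ h ∂ρ, P = 0 → a h = 0 := by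
      by_cases hz : P = 0
      · exact (hP0 hz).mono fun h hh _ => hh
      · exact ae_of_all _ fun h hh => absurd hh hz
    have h2 : ∀ᵐ h ∂ρ, 1 - P = 0 → 1 - a h = 0 := by
      by_cases hz : 1 - P = 0
      · exact (hP1' hz).mono fun h hh _ => hh
      · exact ae_of_all _ fun h hh => absurd hh hz
    filter_upwards [h1, h2, hfin] with h h1 h2 h3
    obtain ⟨h4, h5⟩ := ac_of_kl_ne_top h3
    rw [kl_of_ac h4 h5]
    refine ENNReal.ofReal_le_ofReal (add_le_add ?_ ?_)
    · exact mul_log_div_ge_tangent (ha01 h).1 (hb01 h).1 h4 hPmem.1 hQpos h1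
    · exact mul_log_div_ge_tangent (by linarith [(ha01 h).2]) (by linarith [(hb01 h).2])
        (fun hh => by linarith [h5 (by linarith)]) (by linarith [hPmem.2]) (by linarith) h2
  calc ENNReal.ofReal (∫ h, T h ∂ρ) ≤ ENNReal.ofReal (∫ h, max (T h) 0 ∂ρ) :=
        ENNReal.ofReal_le_ofReal (integral_mono hTint hTint.pos_part fun h => le_max_left _ _)
    _ = ∫⁻ h, ENNReal.ofReal (max (T h) 0) ∂ρ :=
        ofReal_integral_eq_lintegral_ofReal hTint.pos_part (ae_of_all _ fun h => le_max_right _ _)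
    _ ≤ ∫⁻ h, kl (a h) (b h) ∂ρ := by
        refine lintegral_mono_ae (hle.mono fun h hh => ?_)
        rwa [ENNReal.ofReal_max, ENNReal.ofReal_zero, max_eq_left zero_le]

/-- For `k` successes in `n` trials, `exp (n kl(k/n‖p))` is the ratio of the maximal likelihood to
the likelihood at `p`. The inequality is strict where the likelihood at `p` vanishes: there `kl` is
`∞` and the left-hand side is `0 * ∞ = 0`. -/
theorem likelihood_mul_exp_kl_le {n k : ℕ} (hn : n ≠ 0) (hk : k ≤ n) {p : ℝ}
    (hp : p ∈ Icc (0 : ℝ) 1) :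
    ENNReal.ofReal p ^ k * ENNReal.ofReal (1 - p) ^ (n - k)
        * EReal.exp ((n * kl ((k : ℝ) / n) p : ℝ≥0∞) : EReal)
      ≤ ENNReal.ofReal (((k : ℝ) / n) ^ k * (1 - (k : ℝ) / n) ^ (n - k)) := by
  have hn' : (0 : ℝ) < n := by exact_mod_cast Nat.pos_of_ne_zero hn
  have hkn : (k : ℝ) ≤ n := by exact_mod_cast hk
  by_cases h0 : p = 0 ∧ k ≠ 0
  · simp [h0.1, h0.2]
  by_cases h1 : p = 1 ∧ k ≠ n
  · have : n - k ≠ 0 := by have := h1.2; omega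
    simp [h1.1, this]
  have h0' : p = 0 → k = 0 := fun h => by by_contra hc; exact h0 ⟨h, hc⟩
  have h1' : p = 1 → k = n := fun h => by by_contra hc; exact h1 ⟨h, hc⟩
  have hq : (k : ℝ) / n ∈ Icc (0 : ℝ) 1 := ⟨by positivity, by rw [div_le_one hn']; exact hkn⟩
  have hac0 : p = 0 → (k : ℝ) / n = 0 := fun h => by simp [h0' h]
  have hac1 : p = 1 → (k : ℝ) / n = 1 := fun h => by rw [h1' h]; exact div_self hn'.ne'
  have hnn := kl_real_nonneg hq hp hac0 hac1
  rw [kl_of_ac hac0 hac1]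
  set q := (k : ℝ) / n with hqdef
  have e1 : n * q = k := by rw [hqdef]; field_simp
  have e2 : n * (1 - q) = (n - k : ℕ) := by rw [mul_sub, e1, Nat.cast_sub hk]; ring
  have hexp : EReal.exp (((n : ℝ≥0∞) * ENNReal.ofReal
        (q * Real.log (q / p) + (1 - q) * Real.log ((1 - q) / (1 - p))) : ℝ≥0∞) : EReal)
      = ENNReal.ofReal (Real.exp (k * Real.log (q / p))
        * Real.exp ((n - k : ℕ) * Real.log ((1 - q) / (1 - p)))) := by
    rw [← ENNReal.ofReal_natCast n, ← ENNReal.ofReal_mul (by positivity),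
      EReal.coe_ennreal_ofReal, max_eq_left (by positivity), EReal.exp_coe, ← Real.exp_add, ← e2,
      ← e1]
    congr 2; ring
  rw [hexp, ← ENNReal.ofReal_pow hp.1, ← ENNReal.ofReal_pow (by linarith [hp.2]),
    ← ENNReal.ofReal_mul (pow_nonneg hp.1 _),
    ← ENNReal.ofReal_mul (mul_nonneg (pow_nonneg hp.1 _) (pow_nonneg (by linarith [hp.2]) _))]
  refine ENNReal.ofReal_le_ofReal (le_of_eq ?_)
  rw [mul_mul_mul_comm]
  congr 1
  · rcases Nat.eq_zero_or_pos k with hk0 | hk0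
    · simp [hk0]
    · have hp0 : 0 < p := hp.1.lt_of_ne fun h => hk0.ne' (h0' h.symm)
      have hq0 : 0 < q := by rw [hqdef]; positivity
      rw [Real.exp_nat_mul, Real.exp_log (by positivity), ← mul_pow, mul_div_cancel₀ _ hp0.ne']
  · rcases Nat.eq_zero_or_pos (n - k) with hk0 | hk0
    · simp [hk0]
    · have hp0 : 0 < 1 - p := by
        have : p ≠ 1 := fun h => by have := h1' h; omega
        have := hp.2.lt_of_ne this; linarith
      have hq0 : 0 < 1 - q := by
        have : (0 : ℝ) < (n - k : ℕ) := by exact_mod_cast hk0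
        rw [← e2] at this
        exact pos_of_mul_pos_right this hn'.le
      rw [Real.exp_nat_mul, Real.exp_log (by positivity), ← mul_pow, mul_div_cancel₀ _ hp0.ne']

theorem klInvUpper_bddAbove (phat : ℝ) (ε : ℝ≥0∞) :
    BddAbove {p : ℝ | p ∈ Icc (0 : ℝ) 1 ∧ kl phat p ≤ ε} :=
  ⟨1, fun _ hp => hp.1.2⟩

theorem klInvUpper_top (phat : ℝ) : klInvUpper phat ∞ = 1 := by
  refine le_antisymm (csSup_le ⟨1, by simp⟩ fun _ hp => hp.1.2) ?_
  exact le_csSup (klInvUpper_bddAbove _ _) (by simp)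

/-- The strict inequality for `kl` gives the strict inequality for its inverse, except at the right
end point of `[0, 1]`, since `kl(p̂‖·)` is continuous from the right at every `p < 1` where it is
finite. -/
theorem lt_klInvUpper_or {phat p : ℝ} (hp : p ∈ Icc (0 : ℝ) 1) {ε : ℝ≥0∞} (h : kl phat p < ε) :
    p < klInvUpper phat ε ∨ p = 1 ∧ klInvUpper phat ε = 1 := by
  have hle : p ≤ klInvUpper phat ε := le_csSup (klInvUpper_bddAbove _ _) ⟨hp, h.le⟩
  have hle1 : klInvUpper phat ε ≤ 1 := csSup_le ⟨p, hp, h.le⟩ fun _ hp => hp.1.2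
  rcases hp.2.eq_or_lt with h1 | hlt
  · exact Or.inr ⟨h1, le_antisymm hle1 (h1 ▸ hle)⟩
  left
  obtain ⟨h0, -⟩ := ac_of_kl_ne_top (h.trans_le le_top).ne
  set g : ℝ → ℝ := fun q =>
    phat * Real.log (phat / q) + (1 - phat) * Real.log ((1 - phat) / (1 - q)) with hg
  have hcont : ContinuousAt g p := by
    refine ContinuousAt.add ?_ ?_
    · by_cases hz : phat = 0
      · simp only [hz, zero_mul]; exact continuousAt_const
      · have hp0 : p ≠ 0 := fun h => hz (h0 h)
        exact continuousAt_const.mul ((continuousAt_const.div continuousAt_id hp0).log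
          (div_ne_zero hz hp0))
    · by_cases hz : 1 - phat = 0
      · simp only [hz, zero_mul]; exact continuousAt_const
      · have hp0 : 1 - p ≠ 0 := by linarith
        exact continuousAt_const.mul ((continuousAt_const.div
          (continuousAt_const.sub continuousAt_id) hp0).log (div_ne_zero hz hp0))
  have hev : ∀ᶠ q in nhdsWithin p (Ioi p), ENNReal.ofReal (g q) < ε := by
    have : ENNReal.ofReal (g p) < ε := by
      rwa [kl_of_ac h0 fun h => absurd h hlt.ne] at h
    exact (ENNReal.continuous_ofReal.continuousAt.comp hcont).tendsto.eventually
      (eventually_lt_nhds this) |>.filter_mono nhdsWithin_le_nhds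
  have hev2 : ∀ᶠ q in nhdsWithin p (Ioi p), q ∈ Ioo p 1 := Ioo_mem_nhdsGT hlt
  obtain ⟨q, hq1, hq2⟩ := (hev.and hev2).exists
  have hq : kl phat q ≤ ε := by
    rw [kl_of_ac (fun h => absurd h (hp.1.trans_lt hq2.1).ne') fun h => absurd h hq2.2.ne]
    exact hq1.le
  exact hq2.1.trans_le
    (le_csSup (klInvUpper_bddAbove _ _) ⟨⟨hp.1.trans hq2.1.le, hq2.2.le⟩, hq⟩)

/-! ### The change of measure inequality -/

/-- The Donsker–Varadhan change of measure inequality, for functions with values in `[0, ∞]`. -/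
theorem lintegral_lt_klDiv_add_log {H : Type*} [MeasurableSpace H] {ρ π : Measure H}
    [IsProbabilityMeasure ρ] [IsProbabilityMeasure π] (hkl : InformationTheory.klDiv ρ π ≠ ∞)
    {f : H → ℝ≥0∞} (hf : Measurable f) {c : ℝ}
    (hc : ∫⁻ h, EReal.exp (f h : EReal) ∂π < ENNReal.ofReal c) :
    ∫⁻ h, f h ∂ρ < InformationTheory.klDiv ρ π + ENNReal.ofReal (Real.log c) := by
  obtain ⟨hac, hllr⟩ := InformationTheory.klDiv_ne_top_iff.1 hkl
  have hmexp : Measurable fun h => EReal.exp (f h : EReal) :=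
    EReal.measurable_exp.comp (measurable_coe_ennreal_ereal.comp hf)
  set Z := ∫⁻ h, EReal.exp (f h : EReal) ∂π with hZ
  have hZtop : Z ≠ ∞ := (hc.trans ENNReal.ofReal_lt_top).ne
  have hZ1 : 1 ≤ Z := by
    calc (1 : ℝ≥0∞) = ∫⁻ _, 1 ∂π := by simp
      _ ≤ Z := lintegral_mono fun h => by
        rw [← EReal.exp_zero]; exact EReal.exp_monotone (EReal.coe_ennreal_nonneg _)
  have hZr1 : 1 ≤ Z.toReal := by
    rw [← ENNReal.toReal_one]; exact ENNReal.toReal_mono hZtop hZ1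
  have hZrc : Z.toReal < c := by
    have := (ENNReal.lt_ofReal_iff_toReal_lt hZtop).1 hc
    exact this
  have hfin : ∀ᵐ h ∂π, f h ≠ ∞ := (ae_lt_top hmexp hZtop).mono fun h hh hf => by simp [hf] at hh
  have hfinρ : ∀ᵐ h ∂ρ, f h ≠ ∞ := hac.ae_le hfin
  set g : H → ℝ := fun h => (f h).toReal with hg
  have hgm : Measurable g := hf.ennreal_toReal
  set r : H → ℝ := fun h => (ρ.rnDeriv π h).toReal with hr
  have hrm : Measurable r := (Measure.measurable_rnDeriv ρ π).ennreal_toReal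
  have hrpos : ∀ᵐ h ∂ρ, 0 < r h := by
    filter_upwards [Measure.rnDeriv_pos hac, hac.ae_le (Measure.rnDeriv_lt_top ρ π)] with h h1 h2
    exact ENNReal.toReal_pos h1.ne' h2.ne
  have hgexp : ∀ᵐ h ∂π, EReal.exp (f h : EReal) = ENNReal.ofReal (Real.exp (g h)) := by
    filter_upwards [hfin] with h hh
    simp only [hg]
    rw [← EReal.exp_coe, ← EReal.toReal_coe_ennreal, EReal.coe_toReal (by simpa using hh) (by simp)]
  -- `∫ exp g / r dρ ≤ Z`, where `r` is the density of `ρ`.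
  have hle : ∫⁻ h, ENNReal.ofReal (Real.exp (g h) / r h) ∂ρ ≤ Z := by
    rw [← lintegral_rnDeriv_mul hac (by fun_prop)]
    refine lintegral_mono_ae ?_
    filter_upwards [hgexp, Measure.rnDeriv_lt_top ρ π] with h h1 h2
    rw [h1, ← ENNReal.ofReal_toReal h2.ne, ← ENNReal.ofReal_mul ENNReal.toReal_nonneg]
    refine ENNReal.ofReal_le_ofReal ?_
    change r h * (Real.exp (g h) / r h) ≤ _
    rcases eq_or_ne (r h) 0 with h0 | h0
    · rw [h0]; simpa using (Real.exp_pos _).le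
    · rw [mul_div_cancel₀ _ h0]
  have hr0 : ∀ h, 0 ≤ Real.exp (g h) / r h := fun h =>
    div_nonneg (Real.exp_pos _).le ENNReal.toReal_nonneg
  have hdm : Measurable fun h => Real.exp (g h) / r h := hgm.exp.div hrm
  have hEint : Integrable (fun h => Real.exp (g h) / r h) ρ := by
    refine ⟨hdm.aestronglyMeasurable, ?_⟩
    rw [hasFiniteIntegral_iff_ofReal (ae_of_all _ hr0)]
    exact hle.trans_lt hZtop.lt_top
  have hEle : ∫ h, Real.exp (g h) / r h ∂ρ ≤ Z.toReal := by
    rw [integral_eq_lintegral_of_nonneg_ae (ae_of_all _ hr0) hdm.aestronglyMeasurable]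
    exact ENNReal.toReal_mono hZtop hle
  -- This is `log u ≤ u - 1` at `u = exp g / (r Z)`.
  have hpt : ∀ᵐ h ∂ρ, g h ≤ Real.log Z.toReal + llr ρ π h
      + ((Real.exp (g h) / r h) / Z.toReal - 1) := by
    filter_upwards [hrpos] with h hh
    have hu : 0 < (Real.exp (g h) / r h) / Z.toReal := by positivity
    have := Real.log_le_sub_one_of_pos hu
    rw [Real.log_div (by positivity) (by positivity), Real.log_div (by positivity) hh.ne',
      Real.log_exp] at this
    change g h ≤ Real.log Z.toReal + Real.log (r h) + _
    linarith
  have hRint : Integrable (fun h => Real.log Z.toReal + llr ρ π h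
      + ((Real.exp (g h) / r h) / Z.toReal - 1)) ρ :=
    ((integrable_const _).add hllr).add ((hEint.div_const _).sub (integrable_const _))
  have hg0 : ∀ h, 0 ≤ g h := fun h => ENNReal.toReal_nonneg
  have hgint : Integrable g ρ := by
    refine hRint.mono' hgm.aestronglyMeasurable (hpt.mono fun h hh => ?_)
    rwa [Real.norm_of_nonneg (hg0 h)]
  have hI : ∫ h, g h ∂ρ ≤ Real.log Z.toReal + ∫ h, llr ρ π h ∂ρ := by
    have h1 := integral_mono_ae hgint hRint hpt
    have h2 : ∫ h, (Real.log Z.toReal + llr ρ π h + ((Real.exp (g h) / r h) / Z.toReal - 1)) ∂ρ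
        = Real.log Z.toReal + ∫ h, llr ρ π h ∂ρ
          + ((∫ h, Real.exp (g h) / r h ∂ρ) / Z.toReal - 1) := by
      have hi1 : Integrable (fun h => Real.log Z.toReal + llr ρ π h) ρ :=
        (integrable_const _).add hllr
      have hi2 : Integrable (fun h => (Real.exp (g h) / r h) / Z.toReal - 1) ρ :=
        (hEint.div_const _).sub (integrable_const _)
      rw [integral_add hi1 hi2, integral_add (integrable_const _) hllr,
        integral_sub (hEint.div_const _) (integrable_const _), integral_div]
      simp
    have h3 : (∫ h, Real.exp (g h) / r h ∂ρ) / Z.toReal ≤ 1 := by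
      rw [div_le_one (by linarith)]; exact hEle
    linarith
  have hflint : ∫⁻ h, f h ∂ρ = ENNReal.ofReal (∫ h, g h ∂ρ) := by
    rw [ofReal_integral_eq_lintegral_ofReal hgint (ae_of_all _ hg0)]
    exact lintegral_congr_ae (hfinρ.mono fun h hh => (ENNReal.ofReal_toReal hh).symm)
  have hKL : InformationTheory.klDiv ρ π = ENNReal.ofReal (∫ h, llr ρ π h ∂ρ) := by
    rw [InformationTheory.klDiv_of_ac_of_integrable hac hllr]; simp
  have hKL0 : 0 ≤ ∫ h, llr ρ π h ∂ρ := by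
    have := InformationTheory.integral_llr_add_sub_measure_univ_nonneg hac hllr
    simpa using this
  have hlog : Real.log Z.toReal < Real.log c := Real.log_lt_log (by linarith) hZrc
  have hlog0 : 0 ≤ Real.log Z.toReal := Real.log_nonneg hZr1
  rw [hflint, hKL, ← ENNReal.ofReal_add hKL0 (by linarith)]
  exact (ENNReal.ofReal_lt_ofReal_iff (by linarith)).2 (by linarith)

/-! ### The PAC-Bayes-kl inequality for random priors -/

section Disintegration

variable {Ω Θ E ι : Type*} [MeasurableSpace Ω] [MeasurableSpace Θ] [mE : MeasurableSpace E]
  [Fintype ι]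

theorem measurable_pi_kernel (κ : Kernel Θ E) [IsMarkovKernel κ] :
    Measurable fun θ => Measure.pi fun _ : ι => κ θ := by
  refine Measurable.measure_of_isPiSystem_of_isProbabilityMeasure generateFrom_pi.symm
    isPiSystem_pi ?_
  rintro _ ⟨B, hB, rfl⟩
  simp only [Measure.pi_pi]
  exact Finset.measurable_prod _ fun i _ => κ.measurable_coe (hB i (mem_univ i))

/-- If, on boxes with sides in a generating π-system, the `W i` behave as if they were conditionally
independent with the common conditional law `κ (θ ω)`, then they can be integrated out. -/
theorem lintegral_eq_lintegral_pi_of_box (μ : Measure Ω) [IsProbabilityMeasure μ] {θ : Ω → Θ}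
    (hθ : Measurable θ) {W : ι → Ω → E} (hW : ∀ i, Measurable (W i)) (κ : Kernel Θ E)
    [IsMarkovKernel κ] {C : Set (Set E)} (hC : IsPiSystem C) (hgen : mE = .generateFrom C)
    (huniv : univ ∈ C)
    (hlaw : ∀ A : Set Θ, MeasurableSet A → ∀ B : ι → Set E, (∀ i, B i ∈ C) →
      μ (θ ⁻¹' A ∩ {ω | ∀ i, W i ω ∈ B i}) = ∫⁻ ω in θ ⁻¹' A, ∏ i, κ (θ ω) (B i) ∂μ)
    {f : Θ × (ι → E) → ℝ≥0∞} (hf : Measurable f) :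
    ∫⁻ ω, f (θ ω, fun i => W i ω) ∂μ
      = ∫⁻ ω, ∫⁻ w, f (θ ω, w) ∂(Measure.pi fun _ => κ (θ ω)) ∂μ := by
  have hCm : ∀ B ∈ C, MeasurableSet B := fun B hB => by
    rw [hgen]; exact MeasurableSpace.measurableSet_generateFrom hB
  have hspan : IsCountablySpanning C := ⟨fun _ => univ, fun _ => huniv, iUnion_const _⟩
  set κp : Kernel Θ (ι → E) := ⟨fun θ => Measure.pi fun _ => κ θ, measurable_pi_kernel κ⟩ with hκp
  have : IsMarkovKernel κp := ⟨fun θ => by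
    change IsProbabilityMeasure (Measure.pi fun _ => κ θ); infer_instance⟩
  have hV : Measurable fun ω => (θ ω, fun i => W i ω) := hθ.prodMk (measurable_pi_lambda _ hW)
  have : IsProbabilityMeasure (μ.map θ) := Measure.isProbabilityMeasure_map hθ.aemeasurable
  have : IsProbabilityMeasure (μ.map fun ω => (θ ω, fun i => W i ω)) :=
    Measure.isProbabilityMeasure_map hV.aemeasurable
  have heq : μ.map (fun ω => (θ ω, fun i => W i ω)) = (μ.map θ).compProd κp := by
    refine ext_of_generate_finite
      (image2 (· ×ˢ ·) {A : Set Θ | MeasurableSet A} (pi univ '' pi univ fun _ : ι => C))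
      (generateFrom_eq_prod MeasurableSpace.generateFrom_measurableSet
        (generateFrom_eq_pi (fun _ => hgen.symm) fun _ => hspan) isCountablySpanning_measurableSet
        (IsCountablySpanning.pi fun _ => hspan)).symm
      (MeasurableSpace.isPiSystem_measurableSet.prod (IsPiSystem.pi fun _ => hC)) ?_ (by simp)
    rintro _ ⟨A, hA, _, ⟨B, hB, rfl⟩, rfl⟩
    have hA' : MeasurableSet A := hA
    have hB' : ∀ i, B i ∈ C := fun i => hB i (mem_univ i)
    have hBm : MeasurableSet (pi univ B) :=
      MeasurableSet.univ_pi fun i => hCm _ (hB' i)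
    rw [Measure.map_apply hV (hA'.prod hBm), Measure.compProd_apply_prod hA' hBm,
      setLIntegral_map hA' (κp.measurable_coe hBm) hθ]
    have h1 : (fun ω => (θ ω, fun i => W i ω)) ⁻¹' (A ×ˢ pi univ B)
        = θ ⁻¹' A ∩ {ω | ∀ i, W i ω ∈ B i} := by
      ext ω; simp
    rw [h1, hlaw A hA' B hB']
    refine lintegral_congr fun ω => ?_
    change _ = (Measure.pi fun _ => κ (θ ω)) (pi univ B)
    rw [Measure.pi_pi]
  rw [← lintegral_map hf hV, heq, Measure.lintegral_compProd hf,
    lintegral_map (Measurable.lintegral_kernel_prod_right' hf) hθ]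
  rfl

end Disintegration

section Moment

variable {E ι : Type*} [MeasurableSpace E] [Fintype ι]

/-- The exponential moment of `n kl(p̂‖p)` for the empirical frequency `p̂` of `n` independent
binary random variables with mean `p`. -/
theorem lintegral_pi_exp_kl_le [Nonempty ι] (ν : Measure E) [IsProbabilityMeasure ν] {ℓ : E → ℝ}
    (hℓ : Measurable ℓ) (h01 : ∀ e, ℓ e = 0 ∨ ℓ e = 1) :
    ∫⁻ w : ι → E, EReal.exp ((Fintype.card ι * kl ((1 / (Fintype.card ι : ℝ)) * ∑ i, ℓ (w i))
        (∫ e, ℓ e ∂ν) : ℝ≥0∞) : EReal) ∂(Measure.pi fun _ => ν)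
      ≤ ENNReal.ofReal (2 * √(Fintype.card ι)) := by
  classical
  set n := Fintype.card ι with hn
  have hn0 : n ≠ 0 := Fintype.card_ne_zero
  set U : Set E := ℓ ⁻¹' {1} with hU
  have hUm : MeasurableSet U := hℓ (measurableSet_singleton 1)
  have hℓU : ℓ = U.indicator 1 := by
    ext e
    rcases h01 e with h | h
    · rw [indicator_of_notMem (by simp [hU, h]), h]
    · rw [indicator_of_mem (by simp [hU, h]), h]; rfl
  set p := ∫ e, ℓ e ∂ν with hp
  have hpU : p = ν.real U := by rw [hp, hℓU, integral_indicator_one hUm]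
  have hp01 : p ∈ Icc (0 : ℝ) 1 := by
    rw [hpU]; exact ⟨measureReal_nonneg, measureReal_le_one⟩
  have hνU : ν U = ENNReal.ofReal p := by rw [hpU, ofReal_measureReal]
  have hνUc : ν Uᶜ = ENNReal.ofReal (1 - p) := by
    rw [hpU, ← probReal_compl_eq_one_sub hUm, ofReal_measureReal]
  set Φ : ℕ → ℝ≥0∞ := fun k => EReal.exp ((n * kl ((k : ℝ) / n) p : ℝ≥0∞) : EReal) with hΦ
  -- `R s` is the event that the successes occur exactly at the indices in `s`.
  set R : Finset ι → Set (ι → E) := fun s => pi univ fun i => if i ∈ s then U else Uᶜ with hR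
  have hRm : ∀ s, MeasurableSet (R s) := fun s => MeasurableSet.univ_pi fun i => by
    split_ifs; exacts [hUm, hUm.compl]
  have hsum : ∀ w : ι → E, EReal.exp ((n * kl ((1 / (n : ℝ)) * ∑ i, ℓ (w i)) p : ℝ≥0∞) : EReal)
      ≤ ∑ s : Finset ι, (R s).indicator (fun _ => Φ s.card) w := by
    intro w
    set s : Finset ι := Finset.univ.filter fun i => w i ∈ U with hs
    have hw : w ∈ R s := by
      intro i _
      by_cases h : w i ∈ U <;> simp [hs, h]
    have hcard : ∑ i, ℓ (w i) = s.card := by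
      rw [hℓU, hs, Finset.card_filter]
      push_cast
      exact Finset.sum_congr rfl fun i _ => by simp [indicator_apply]
    calc _ = (R s).indicator (fun _ => Φ s.card) w := by
          rw [indicator_of_mem hw, hcard, hΦ, one_div_mul_eq_div]
      _ ≤ _ := Finset.single_le_sum (f := fun s => (R s).indicator (fun _ => Φ s.card) w)
          (fun _ _ => zero_le) (Finset.mem_univ s)
  have hRν : ∀ s : Finset ι, (Measure.pi fun _ : ι => ν) (R s)
      = ENNReal.ofReal p ^ s.card * ENNReal.ofReal (1 - p) ^ (n - s.card) := by
    intro s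
    rw [hR, Measure.pi_pi]
    simp only [apply_ite ν, hνU, hνUc]
    rw [Finset.prod_ite, Finset.prod_const, Finset.prod_const]
    congr 2
    · simp
    · rw [Finset.filter_not, Finset.card_sdiff]; simp [hn]
  calc _ ≤ ∫⁻ w, ∑ s : Finset ι, (R s).indicator (fun _ => Φ s.card) w
        ∂(Measure.pi fun _ : ι => ν) := lintegral_mono hsum
    _ = ∑ s : Finset ι, ENNReal.ofReal p ^ s.card * ENNReal.ofReal (1 - p) ^ (n - s.card)
          * Φ s.card := by
        rw [lintegral_finsetSum _ fun s _ => measurable_const.indicator (hRm s)]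
        refine Finset.sum_congr rfl fun s _ => ?_
        rw [lintegral_indicator_const (hRm s), hRν, mul_comm]
    _ ≤ ∑ s : Finset ι, ENNReal.ofReal (((s.card : ℝ) / n) ^ s.card
          * (1 - (s.card : ℝ) / n) ^ (n - s.card)) :=
        Finset.sum_le_sum fun s _ => likelihood_mul_exp_kl_le hn0 s.card_le_univ hp01
    _ = ENNReal.ofReal (∑ k ∈ Finset.range (n + 1),
          (n.choose k : ℝ) * ((k : ℝ) / n) ^ k * (1 - (k : ℝ) / n) ^ (n - k)) := by
        have hnn : ∀ k ∈ Finset.range (n + 1),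
            0 ≤ ((k : ℝ) / n) ^ k * (1 - (k : ℝ) / n) ^ (n - k) := fun k hk => by
          have hk' : (k : ℝ) ≤ n := by exact_mod_cast Finset.mem_range_succ_iff.1 hk
          have : (k : ℝ) / n ≤ 1 := div_le_one_of_le₀ hk' (by positivity)
          have : 0 ≤ 1 - (k : ℝ) / n := by linarith
          positivity
        rw [← Finset.powerset_univ, Finset.sum_powerset_apply_card (fun k =>
          ENNReal.ofReal (((k : ℝ) / n) ^ k * (1 - (k : ℝ) / n) ^ (n - k))), Finset.card_univ,
          ← hn, ENNReal.ofReal_sum_of_nonneg fun k hk => by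
            rw [mul_assoc]; exact mul_nonneg (by positivity) (hnn k hk)]
        refine Finset.sum_congr rfl fun k hk => ?_
        rw [mul_assoc, ENNReal.ofReal_mul (p := (n.choose k : ℝ)) (by positivity), nsmul_eq_mul,
          ENNReal.ofReal_natCast]
    _ ≤ _ := ENNReal.ofReal_le_ofReal (sum_choose_mul_pow_mul_pow_le hn0)

end Moment

section PACBayes

variable {Ω Θ E H ι : Type*} [MeasurableSpace Ω] [MeasurableSpace Θ] [mE : MeasurableSpace E]
  [MeasurableSpace H] [Fintype ι]

/-- The PAC-Bayes-kl inequality with a prior `π (θ ω)`, a binary loss `ℓ (θ ω)` and a law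
`κ (θ ω)` of the observations `W i` that all depend on the information `θ ω`. -/
theorem pacBayes_kl [Nonempty ι] (μ : Measure Ω) [IsProbabilityMeasure μ] {θ : Ω → Θ}
    (hθ : Measurable θ) {W : ι → Ω → E} (hW : ∀ i, Measurable (W i)) (κ : Kernel Θ E)
    [IsMarkovKernel κ] (π : Kernel Θ H) [IsMarkovKernel π]
    {C : Set (Set E)} (hC : IsPiSystem C) (hgen : mE = .generateFrom C) (huniv : univ ∈ C)
    (hlaw : ∀ A : Set Θ, MeasurableSet A → ∀ B : ι → Set E, (∀ i, B i ∈ C) →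
      μ (θ ⁻¹' A ∩ {ω | ∀ i, W i ω ∈ B i}) = ∫⁻ ω in θ ⁻¹' A, ∏ i, κ (θ ω) (B i) ∂μ)
    {ℓ : Θ → H → E → ℝ} (hℓ : Measurable fun x : (Θ × H) × E => ℓ x.1.1 x.1.2 x.2)
    (h01 : ∀ θ h e, ℓ θ h e = 0 ∨ ℓ θ h e = 1) {c : ℝ} (hc : 0 < c) :
    μ {ω | ∃ ρ : Measure H, IsProbabilityMeasure ρ ∧ InformationTheory.klDiv ρ (π (θ ω)) ≠ ∞ ∧
        (InformationTheory.klDiv ρ (π (θ ω))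
            + ENNReal.ofReal (Real.log (2 * √(Fintype.card ι) / c))) / (Fintype.card ι : ℝ≥0∞)
          ≤ kl (∫ h, (1 / (Fintype.card ι : ℝ)) * ∑ i, ℓ (θ ω) h (W i ω) ∂ρ)
            (∫ h, ∫ e, ℓ (θ ω) h e ∂(κ (θ ω)) ∂ρ)}
      ≤ ENNReal.ofReal c := by
  set n := Fintype.card ι with hn
  have hn0 : n ≠ 0 := Fintype.card_ne_zero
  have hnR : (0 : ℝ) < n := by exact_mod_cast Nat.pos_of_ne_zero hn0
  set phat : Θ → (ι → E) → H → ℝ := fun θ w h => (1 / (n : ℝ)) * ∑ i, ℓ θ h (w i) with hphat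
  set p : Θ → H → ℝ := fun θ h => ∫ e, ℓ θ h e ∂(κ θ) with hp
  have hℓnn : ∀ θ h e, 0 ≤ ℓ θ h e := fun θ h e => by rcases h01 θ h e with h | h <;> simp [h]
  have hℓle : ∀ θ h e, ℓ θ h e ≤ 1 := fun θ h e => by rcases h01 θ h e with h | h <;> simp [h]
  have hpm : Measurable fun x : Θ × H => p x.1 x.2 := by
    have := (hℓ.stronglyMeasurable).integral_kernel_prod_right'
      (κ := κ.comap Prod.fst (measurable_fst : Measurable (Prod.fst : Θ × H → Θ)))
    exact this.measurable
  have hphatm : Measurable fun x : (Θ × (ι → E)) × H => phat x.1.1 x.1.2 x.2 := by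
    refine measurable_const.mul (Finset.measurable_sum _ fun i _ => ?_)
    have : Measurable fun x : (Θ × (ι → E)) × H => (((x.1.1, x.2), x.1.2 i) : (Θ × H) × E) :=
      (measurable_fst.fst.prodMk measurable_snd).prodMk
        ((measurable_pi_apply i).comp measurable_fst.snd)
    exact hℓ.comp this
  have hp01 : ∀ θ h, p θ h ∈ Icc (0 : ℝ) 1 := fun θ h =>
    integral_mem_Icc _ fun e => ⟨hℓnn θ h e, hℓle θ h e⟩
  have hphat01 : ∀ θ w h, phat θ w h ∈ Icc (0 : ℝ) 1 := fun θ w h => by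
    refine ⟨mul_nonneg (by positivity) (Finset.sum_nonneg fun i _ => hℓnn θ h _), ?_⟩
    have : ∑ i, ℓ θ h (w i) ≤ ∑ _i : ι, (1 : ℝ) := Finset.sum_le_sum fun i _ => hℓle θ h _
    rw [Finset.sum_const, Finset.card_univ, nsmul_eq_mul, mul_one, ← hn] at this
    simp only [hphat]
    rw [one_div_mul_eq_div]
    exact div_le_one_of_le₀ this hnR.le
  -- `f` is the prior average of the exponentials, as a function of the information and the data.
  set g : (Θ × (ι → E)) × H → ℝ≥0∞ := fun x =>
    n * kl (phat x.1.1 x.1.2 x.2) (p x.1.1 x.2) with hg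
  have hgm : Measurable g := by
    have h1 : Measurable fun x : (Θ × (ι → E)) × H => p x.1.1 x.2 :=
      hpm.comp (measurable_fst.fst.prodMk measurable_snd)
    exact measurable_const.mul (measurable_kl.comp (hphatm.prodMk h1))
  have hexpm : Measurable fun x => EReal.exp (g x : EReal) :=
    EReal.measurable_exp.comp (measurable_coe_ennreal_ereal.comp hgm)
  set f : Θ × (ι → E) → ℝ≥0∞ := fun x => ∫⁻ h, EReal.exp (g (x, h) : EReal) ∂(π x.1) with hf
  have hfm : Measurable f := by
    exact Measurable.lintegral_kernel_prod_right' (κ := π.comap Prod.fst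
      (measurable_fst : Measurable (Prod.fst : Θ × (ι → E) → Θ))) hexpm
  have hmean : ∫⁻ ω, f (θ ω, fun i => W i ω) ∂μ ≤ ENNReal.ofReal (2 * √n) := by
    rw [lintegral_eq_lintegral_pi_of_box μ hθ hW κ hC hgen huniv hlaw hfm]
    calc _ ≤ ∫⁻ _ω, ENNReal.ofReal (2 * √n) ∂μ := ?_
      _ = _ := by simp
    refine lintegral_mono fun ω => ?_
    simp only [hf]
    rw [lintegral_lintegral_swap]
    · calc _ ≤ ∫⁻ _h, ENNReal.ofReal (2 * √n) ∂(π (θ ω)) := ?_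
        _ = _ := by simp
      refine lintegral_mono fun h => ?_
      have hm : Measurable (ℓ (θ ω) h) :=
        hℓ.comp (measurable_const.prodMk measurable_id : Measurable fun e => ((θ ω, h), e))
      exact lintegral_pi_exp_kl_le (κ (θ ω)) hm (h01 (θ ω) h)
    · have : Measurable fun x : (ι → E) × H => (((θ ω, x.1), x.2) : (Θ × (ι → E)) × H) :=
        (measurable_const.prodMk measurable_fst).prodMk measurable_snd
      exact (hexpm.comp this).aemeasurable
  have hpos : 0 < 2 * √(n : ℝ) / c := by positivity
  have hmarkov : μ {ω | ENNReal.ofReal (2 * √n / c) ≤ f (θ ω, fun i => W i ω)}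
      ≤ ENNReal.ofReal c := by
    have h1 := meas_ge_le_lintegral_div (μ := μ)
      (hfm.comp (hθ.prodMk (measurable_pi_lambda _ hW))).aemeasurable
      (ε := ENNReal.ofReal (2 * √n / c)) (by simpa using hpos) ENNReal.ofReal_ne_top
    refine h1.trans ((ENNReal.div_le_div_right hmean _).trans_eq ?_)
    rw [← ENNReal.ofReal_div_of_pos hpos]
    congr 1
    have : √(n : ℝ) ≠ 0 := by positivity
    field_simp
  refine (measure_mono ?_).trans hmarkov
  rintro ω ⟨ρ, hρ, hkl, hle⟩
  by_contra hlt
  simp only [mem_ofPred_eq, not_le] at hlt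
  have hsec : Measurable fun h : H => ((θ ω, fun i => W i ω), h) := measurable_const.prodMk
    measurable_id
  have h1 := lintegral_lt_klDiv_add_log hkl (hgm.comp hsec) hlt
  have h2 := kl_integral_le ρ (a := phat (θ ω) fun i => W i ω) (b := p (θ ω))
    (hphatm.comp hsec) (hpm.comp (measurable_const.prodMk measurable_id))
    (hphat01 _ _) (hp01 _)
  have h3 : ∫⁻ h, (g ∘ fun h : H => ((θ ω, fun i => W i ω), h)) h ∂ρ
      = n * ∫⁻ h, kl (phat (θ ω) (fun i => W i ω) h) (p (θ ω) h) ∂ρ := by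
    simp only [hg, Function.comp]
    rw [lintegral_const_mul]
    exact measurable_kl.comp ((hphatm.comp hsec).prodMk
      (hpm.comp (measurable_const.prodMk measurable_id)))
  rw [h3] at h1
  have h4 := (ENNReal.div_le_iff (by exact_mod_cast hn0) (ENNReal.natCast_ne_top n)).1
    (hle.trans h2)
  exact absurd h1 (not_lt.2 (h4.trans_eq (mul_comm _ _)))

end PACBayes

/-! ### Independence of the validation data from the training information -/

section Independence

variable {Ω Z H : Type*}

theorem setLIntegral_inter_of_indep {mV m mΩ : MeasurableSpace Ω} {μ : Measure Ω} (hV : mV ≤ mΩ)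
    (hm : m ≤ mΩ) (hind : Indep mV m μ) {V A : Set Ω} (hVm : MeasurableSet[mV] V)
    (hA : MeasurableSet[m] A) {φ : Ω → ℝ≥0∞} (hφ : Measurable[m] φ) :
    ∫⁻ ω in A ∩ V, φ ω ∂μ = μ V * ∫⁻ ω in A, φ ω ∂μ := by
  have h := lintegral_mul_eq_lintegral_mul_lintegral_of_independent_measurableSpace (μ := μ) hV hm
    hind (f := V.indicator fun _ => 1) (g := A.indicator φ)
    (Measurable.indicator measurable_const hVm) (Measurable.indicator hφ hA)
  rw [lintegral_indicator_const (hV _ hVm), one_mul, lintegral_indicator (hm _ hA)] at h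
  rw [← h, ← lintegral_indicator ((hm _ hA).inter (hV _ hVm))]
  refine lintegral_congr fun ω => ?_
  by_cases h1 : ω ∈ A <;> by_cases h2 : ω ∈ V <;> simp [h1, h2]

/-- Rules drawn from a distribution that is measurable with respect to `m` preserve the independence
of `m` from `mV`. -/
theorem CondIIDFrom.indep_sup [MeasurableSpace H] {mV m mF mΩ : MeasurableSpace Ω} {μ : Measure Ω}
    [IsProbabilityMeasure μ] (hF : mF ≤ mΩ) (hVF : mV ≤ mF) (hmF : m ≤ mF) (hind : Indep mV m μ)
    {n : ℕ} {π : Ω → Measure H} (hπ : Measurable[m] π) {g : Fin n → Ω → H}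
    (hg : ∀ i, Measurable (g i)) (hcond : CondIIDFrom μ mF π g) :
    Indep mV (m ⊔ ⨆ i, MeasurableSpace.comap (g i) inferInstance) μ := by
  set P : Set (Set Ω) := {s | ∃ A, MeasurableSet[m] A ∧ ∃ B : Fin n → Set H,
    (∀ i, MeasurableSet (B i)) ∧ s = A ∩ {ω | ∀ i, g i ω ∈ B i}} with hP
  have hm : m ≤ mΩ := hmF.trans hF
  have hV : mV ≤ mΩ := hVF.trans hF
  have hgle : ∀ i, MeasurableSpace.comap (g i) inferInstance ≤ mΩ := fun i => (hg i).comap_le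
  have hpi : IsPiSystem P := by
    rintro _ ⟨A, hA, B, hB, rfl⟩ _ ⟨A', hA', B', hB', rfl⟩ -
    refine ⟨A ∩ A', hA.inter hA', fun i => B i ∩ B' i, fun i => (hB i).inter (hB' i), ?_⟩
    ext ω
    simp only [mem_inter_iff, mem_ofPred_eq, forall_and]
    tauto
  have hgen : m ⊔ ⨆ i, MeasurableSpace.comap (g i) inferInstance
      = MeasurableSpace.generateFrom P := by
    apply le_antisymm
    · refine sup_le ?_ (iSup_le fun i => ?_)
      · intro A hA
        exact MeasurableSpace.measurableSet_generateFrom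
          ⟨A, hA, fun _ => univ, fun _ => MeasurableSet.univ, by simp⟩
      · rintro _ ⟨B, hB, rfl⟩
        refine MeasurableSpace.measurableSet_generateFrom
          ⟨univ, MeasurableSet.univ, Function.update (fun _ => univ) i B, fun k => ?_, ?_⟩
        · rcases eq_or_ne k i with rfl | hk
          · simpa using hB
          · simp [hk]
        · ext ω
          simp only [mem_preimage, univ_inter, mem_ofPred_eq]
          refine ⟨fun h k => ?_, fun h => by simpa using h i⟩
          rcases eq_or_ne k i with rfl | hk
          · simpa using h
          · simp [hk]
    · refine MeasurableSpace.generateFrom_le ?_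
      rintro _ ⟨A, hA, B, hB, rfl⟩
      set m' := m ⊔ ⨆ i, MeasurableSpace.comap (g i) inferInstance
      have h1 : MeasurableSet[m'] A := (le_sup_left : m ≤ m') _ hA
      have h2 : ∀ i, MeasurableSet[m'] (g i ⁻¹' B i) := fun i =>
        ((le_iSup (fun i => MeasurableSpace.comap (g i) inferInstance) i).trans le_sup_right :
          MeasurableSpace.comap (g i) inferInstance ≤ m') _ ⟨B i, hB i, rfl⟩
      have h3 : {ω | ∀ i, g i ω ∈ B i} = ⋂ i, g i ⁻¹' B i := by ext ω; simp
      rw [h3]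
      exact MeasurableSet.inter h1 (MeasurableSet.iInter h2)
  refine IndepSets.indep hV (sup_le hm (iSup_le hgle))
    (@MeasurableSpace.isPiSystem_measurableSet Ω mV) hpi
    (@MeasurableSpace.generateFrom_measurableSet Ω mV).symm hgen ?_
  rw [IndepSets_iff]
  rintro V _ hVm ⟨A, hA, B, hB, rfl⟩
  have hVm' : MeasurableSet[mV] V := hVm
  have hφ : Measurable[m] fun ω => ∏ i, π ω (B i) :=
    Finset.measurable_prod _ fun i _ => (Measure.measurable_coe (hB i)).comp hπ
  have h1 : V ∩ (A ∩ {ω | ∀ i, g i ω ∈ B i}) = (A ∩ V) ∩ {ω | ∀ i, g i ω ∈ B i} := by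
    rw [inter_left_comm, ← inter_assoc]
  rw [h1, hcond _ ((hmF _ hA).inter (hVF _ hVm')) B hB, hcond _ (hmF _ hA) B hB,
    setLIntegral_inter_of_indep hV hm hind hVm' hA hφ]

/-- The σ-algebra generated by the sample points with indices satisfying `p`. -/
abbrev dataInfo [MeasurableSpace Z] {n : ℕ} (S : Fin n → Ω → Z) (p : Fin n → Prop) :
    MeasurableSpace Ω :=
  ⨆ i, ⨆ (_ : p i), MeasurableSpace.comap (S i) inferInstance

theorem rulesInfo_zero [MeasurableSpace H] {n : ℕ} (hs : ℕ → Fin n → Ω → H) :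
    rulesInfo hs 0 = ⊥ := by
  simp [rulesInfo]

theorem rulesInfo_one [MeasurableSpace H] {n : ℕ} (hs : ℕ → Fin n → Ω → H) :
    rulesInfo hs 1 = ⊥ := by
  simp [rulesInfo]

theorem rulesInfo_succ [MeasurableSpace H] {n : ℕ} (hs : ℕ → Fin n → Ω → H) {s : ℕ} (h1 : 1 ≤ s) :
    rulesInfo hs (s + 1)
      = rulesInfo hs s ⊔ ⨆ i, MeasurableSpace.comap (hs s i) inferInstance := by
  rw [rulesInfo, Finset.Ico_add_one_right_eq_Icc, ← Finset.Ico_insert_right h1,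
    Finset.iSup_insert, sup_comm]

variable [MeasurableSpace Z] [MeasurableSpace H] {mΩ : MeasurableSpace Ω} {n : ℕ}

theorem rulesInfo_le {hs : ℕ → Fin n → Ω → H} (hhs : ∀ t i, Measurable (hs t i)) (t : ℕ) :
    rulesInfo hs t ≤ mΩ :=
  iSup₂_le fun s _ => iSup_le fun i => (hhs s i).comap_le

theorem fullInfo_le {S : Fin n → Ω → Z} (hS : ∀ i, Measurable (S i)) {hs : ℕ → Fin n → Ω → H}
    (hhs : ∀ t i, Measurable (hs t i)) (t : ℕ) : fullInfo S hs t ≤ mΩ :=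
  sup_le (iSup_le fun i => (hS i).comap_le) (rulesInfo_le hhs t)

theorem trainInfo_le_fullInfo (chunk : Fin n → ℕ) (S : Fin n → Ω → Z) (hs : ℕ → Fin n → Ω → H)
    (t : ℕ) : trainInfo chunk S hs t ≤ fullInfo S hs t :=
  sup_le_sup_right (iSup_mono fun _ => iSup_const_le) _

/-- The points outside the first `r` subsamples are independent of all that has been drawn when
`π*_r` is constructed. The rules drawn at a step `s < r` depend on all the data only through
`π*_s`, so that the independence propagates through the steps. -/
theorem indep_dataInfo_trainInfo {μ : Measure Ω} [IsProbabilityMeasure μ] {S : Fin n → Ω → Z}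
    (hS : ∀ i, Measurable (S i)) (hSindep : iIndepFun S μ) {T : ℕ} (chunk : Fin n → ℕ)
    {πs : ℕ → Ω → Measure H} {hs : ℕ → Fin n → Ω → H} (hhs : ∀ t i, Measurable (hs t i))
    (hπ : ∀ t ≤ T, Measurable[trainInfo chunk S hs t] (πs t))
    (hsample : ∀ t, 1 ≤ t → t < T → CondIIDFrom μ (fullInfo S hs t) (πs t) (hs t))
    {r : ℕ} (hr : r ≤ T) :
    Indep (dataInfo S (r < chunk ·)) (trainInfo chunk S hs r) μ := by
  have key : ∀ s ≤ r, Indep (dataInfo S (r < chunk ·))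
      (dataInfo S (chunk · ≤ r) ⊔ rulesInfo hs s) μ := by
    have h0 : Indep (dataInfo S (r < chunk ·)) (dataInfo S (chunk · ≤ r)) μ :=
      indep_iSup_of_disjoint (S := {i | r < chunk i}) (T := {i | chunk i ≤ r})
        (fun i => (hS i).comap_le) hSindep.iIndep (disjoint_left.2 fun i (h1 : r < chunk i)
          (h2 : chunk i ≤ r) => by omega)
    intro s
    induction s with
    | zero => intro _; rwa [rulesInfo_zero, sup_bot_eq]
    | succ s ih =>
      intro hsr
      rcases Nat.eq_zero_or_pos s with rfl | hs1
      · rwa [zero_add, rulesInfo_one, sup_bot_eq]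
      rw [rulesInfo_succ hs hs1, ← sup_assoc]
      have hle : trainInfo chunk S hs s ≤ dataInfo S (chunk · ≤ r) ⊔ rulesInfo hs s :=
        sup_le_sup_right (iSup_mono fun i => iSup_const_mono fun h => by omega) _
      have hdata : ∀ p, dataInfo S p ≤ fullInfo S hs s := fun p =>
        (iSup_mono fun _ => iSup_const_le).trans le_sup_left
      exact (hsample s hs1 (by omega)).indep_sup (fullInfo_le hS hhs s) (hdata _)
        (sup_le (hdata _) le_sup_right) (ih (by omega)) ((hπ s (by omega)).mono hle le_rfl)
        (hhs s)
  exact key r le_rfl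

theorem measurableSet_dataInfo_box {S : Fin n → Ω → Z} {I : Finset (Fin n)} {P : Fin n → Set Z}
    (hP : ∀ i, MeasurableSet (P i)) :
    MeasurableSet[dataInfo S (· ∈ I)] {ω | ∀ i ∈ I, S i ω ∈ P i} := by
  have h : {ω | ∀ i ∈ I, S i ω ∈ P i} = ⋂ i ∈ I, S i ⁻¹' P i := by ext; simp
  rw [h]
  refine Finset.measurableSet_biInter _ fun i hi => ?_
  exact (le_iSup₂_of_le (f := fun i (_ : i ∈ I) =>
    MeasurableSpace.comap (S i) inferInstance) i hi le_rfl) _ ⟨P i, hP i, rfl⟩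

theorem measure_data_box {μ : Measure Ω} {S : Fin n → Ω → Z} (hS : ∀ i, Measurable (S i))
    (hSindep : iIndepFun S μ) {D : Measure Z} (hSlaw : ∀ i, μ.map (S i) = D) (I : Finset (Fin n))
    {P : Fin n → Set Z} (hP : ∀ i, MeasurableSet (P i)) :
    μ {ω | ∀ i ∈ I, S i ω ∈ P i} = ∏ i ∈ I, D (P i) := by
  have h : {ω | ∀ i ∈ I, S i ω ∈ P i} = ⋂ i ∈ I, S i ⁻¹' P i := by ext; simp
  rw [h, hSindep.measure_inter_preimage_eq_mul I fun i _ => hP i]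
  exact Finset.prod_congr rfl fun i _ => by rw [← hSlaw i, Measure.map_apply (hS i) (hP i)]

end Independence

/-! ### The losses and their means -/

section Losses

variable {X Y H : Type*}

theorem loss_eq_zero_or_one (predict : H → X → Y) (h : H) (z : X × Y) :
    loss predict h z = 0 ∨ loss predict h z = 1 := by
  unfold loss; split_ifs <;> simp

theorem splitLoss_eq_zero_or_one (predict : H → X → Y) (γ : ℝ) (j : Fin 4) (h : H) (z : X × Y)
    (h' : H) : splitLoss predict γ j h z h' = 0 ∨ splitLoss predict γ j h z h' = 1 := by
  unfold splitLoss; split_ifs <;> simp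

/-- The excess loss takes its values in `{-γ, 0, 1 - γ, 1}`, and is `-γ` plus the sum of the
steps between consecutive points that it has passed. -/
theorem loss_sub_mul_loss_eq (predict : H → X → Y) {γ : ℝ} (hγ : γ ∈ Icc (0 : ℝ) 1) (h : H)
    (z : X × Y) (h' : H) :
    loss predict h z - γ * loss predict h' z
      = -γ + ∑ j : Fin 3, (bpt γ j.succ - bpt γ j.castSucc)
          * splitLoss predict γ j.succ h z h' := by
  obtain ⟨h0, h1⟩ := hγ
  have e0 : bpt γ 0 = -γ := rfl
  have e1 : bpt γ 1 = 0 := rfl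
  have e2 : bpt γ 2 = 1 - γ := rfl
  have e3 : bpt γ 3 = 1 := rfl
  simp only [Fin.sum_univ_three, splitLoss]
  simp only [Fin.succ_zero_eq_one, Fin.succ_one_eq_two, Fin.castSucc_zero, Fin.castSucc_one,
    show (2 : Fin 3).succ = 3 from rfl, show (2 : Fin 3).castSucc = 2 from rfl, e0, e1, e2, e3]
  rcases loss_eq_zero_or_one predict h z with ha | ha <;>
    rcases loss_eq_zero_or_one predict h' z with hb | hb <;>
    simp only [ha, hb] <;> split_ifs <;> nlinarith

variable [MeasurableSpace X] [MeasurableSpace Y]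

theorem risk_mem_Icc (predict : H → X → Y) (D : Measure (X × Y)) [IsProbabilityMeasure D] (h : H) :
    risk predict D h ∈ Icc (0 : ℝ) 1 :=
  integral_mem_Icc D fun z => by rcases loss_eq_zero_or_one predict h z with h | h <;> simp [h]

variable [MeasurableSpace H]

theorem measurable_loss {predict : H → X → Y}
    (hpredict : MeasurableSet {p : H × X × Y | predict p.1 p.2.1 ≠ p.2.2}) :
    Measurable fun p : H × X × Y => loss predict p.1 p.2 := by
  unfold loss
  exact Measurable.ite hpredict measurable_const measurable_const

theorem measurable_splitLoss {predict : H → X → Y}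
    (hpredict : MeasurableSet {p : H × X × Y | predict p.1 p.2.1 ≠ p.2.2}) (j : Fin 4) :
    Measurable fun x : (ℝ × H) × (X × Y) × H => splitLoss predict x.1.1 j x.1.2 x.2.1 x.2.2 := by
  have hL := measurable_loss hpredict
  have h1 : Measurable fun x : (ℝ × H) × (X × Y) × H => loss predict x.1.2 x.2.1 :=
    hL.comp (measurable_fst.snd.prodMk measurable_snd.fst)
  have h2 : Measurable fun x : (ℝ × H) × (X × Y) × H => loss predict x.2.2 x.2.1 :=
    hL.comp (measurable_snd.snd.prodMk measurable_snd.fst)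
  have h3 : Measurable fun x : (ℝ × H) × (X × Y) × H => bpt x.1.1 j := by
    fin_cases j <;> simp only [bpt] <;> simp <;> fun_prop
  unfold splitLoss
  exact Measurable.ite (measurableSet_le h3 (h1.sub (measurable_fst.fst.mul h2)))
    measurable_const measurable_const

theorem integrable_of_eq_zero_or_one {α : Type*} [MeasurableSpace α] {ν : Measure α}
    [IsFiniteMeasure ν] {f : α → ℝ} (hf : Measurable f) (h01 : ∀ a, f a = 0 ∨ f a = 1) :
    Integrable f ν :=
  Integrable.of_mem_Icc 0 1 hf.aemeasurable (ae_of_all _ fun a => by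
    rcases h01 a with h | h <;> simp [h])

/-- The mean of the binary component `f_{γ|j}(h, ·)` over a data point and a rule from `π`. -/
noncomputable def meanSplit (predict : H → X → Y) (D : Measure (X × Y)) (π : Measure H) (γ : ℝ)
    (j : Fin 4) (h : H) : ℝ :=
  ∫ e, splitLoss predict γ j h e.1 e.2 ∂(D.prod π)

section Mean

variable {predict : H → X → Y}
  (hpredict : MeasurableSet {p : H × X × Y | predict p.1 p.2.1 ≠ p.2.2}) (D : Measure (X × Y))
  [IsProbabilityMeasure D] (π : Measure H) [IsProbabilityMeasure π]

theorem meanSplit_mem_Icc (predict : H → X → Y) (γ : ℝ) (j : Fin 4) (h : H) :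
    meanSplit predict D π γ j h ∈ Icc (0 : ℝ) 1 :=
  integral_mem_Icc _ fun e => by
    rcases splitLoss_eq_zero_or_one predict γ j h e.1 e.2 with h | h <;> simp [h]

include hpredict

theorem measurable_meanSplit (γ : ℝ) (j : Fin 4) : Measurable (meanSplit predict D π γ j) := by
  have : Measurable fun x : H × (X × Y) × H => splitLoss predict γ j x.1 x.2.1 x.2.2 :=
    (measurable_splitLoss hpredict j).comp
      ((measurable_const.prodMk measurable_fst).prodMk measurable_snd)
  exact this.stronglyMeasurable.integral_prod_right'.measurable

theorem integrable_splitLoss (γ : ℝ) (j : Fin 4) (h : H) :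
    Integrable (fun e : (X × Y) × H => splitLoss predict γ j h e.1 e.2) (D.prod π) :=
  integrable_of_eq_zero_or_one
    ((measurable_splitLoss hpredict j).comp (measurable_const.prodMk measurable_id :
      Measurable fun e : (X × Y) × H => ((γ, h), e))) fun _ => splitLoss_eq_zero_or_one ..

theorem integral_prod_loss_left (h : H) :
    Integrable (fun e : (X × Y) × H => loss predict h e.1) (D.prod π) ∧
      ∫ e, loss predict h e.1 ∂(D.prod π) = risk predict D h := by
  have hm : Measurable (loss predict h) :=
    (measurable_loss hpredict).comp (measurable_const.prodMk measurable_id)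
  refine ⟨integrable_of_eq_zero_or_one (hm.comp measurable_fst) fun _ => loss_eq_zero_or_one ..,
    ?_⟩
  rw [integral_fun_fst (loss predict h)]
  simp [risk]

theorem integral_prod_loss_right :
    Integrable (fun e : (X × Y) × H => loss predict e.2 e.1) (D.prod π) ∧
      ∫ e, loss predict e.2 e.1 ∂(D.prod π) = ∫ h, risk predict D h ∂π := by
  have hm : Measurable fun e : (X × Y) × H => loss predict e.2 e.1 :=
    (measurable_loss hpredict).comp measurable_swap
  have hi : Integrable (fun e : (X × Y) × H => loss predict e.2 e.1) (D.prod π) :=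
    integrable_of_eq_zero_or_one hm fun _ => loss_eq_zero_or_one ..
  exact ⟨hi, integral_prod_symm _ hi⟩

/-- The excess risk over `γ` times the risk of `π` is a combination of the means of the binary
components. -/
theorem integral_risk_eq {γ : ℝ} (hγ : γ ∈ Icc (0 : ℝ) 1) (ρ : Measure H)
    [IsProbabilityMeasure ρ] :
    ∫ h, risk predict D h ∂ρ = -γ + ∑ j : Fin 3, (bpt γ j.succ - bpt γ j.castSucc)
      * ∫ h, meanSplit predict D π γ j.succ h ∂ρ + γ * ∫ h, risk predict D h ∂π := by
  have hpt : ∀ h, risk predict D h = -γ + ∑ j : Fin 3, (bpt γ j.succ - bpt γ j.castSucc)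
      * meanSplit predict D π γ j.succ h + γ * ∫ h, risk predict D h ∂π := by
    intro h
    obtain ⟨hi1, he1⟩ := integral_prod_loss_left hpredict D π h
    obtain ⟨hi2, he2⟩ := integral_prod_loss_right hpredict D π
    have h1 : ∫ e : (X × Y) × H, (loss predict h e.1 - γ * loss predict e.2 e.1) ∂(D.prod π)
        = risk predict D h - γ * ∫ h, risk predict D h ∂π := by
      rw [integral_sub hi1 (hi2.const_mul γ), integral_const_mul, he1, he2]
    have h2 : ∫ e : (X × Y) × H, (loss predict h e.1 - γ * loss predict e.2 e.1) ∂(D.prod π)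
        = -γ + ∑ j : Fin 3, (bpt γ j.succ - bpt γ j.castSucc)
          * meanSplit predict D π γ j.succ h := by
      simp only [loss_sub_mul_loss_eq predict hγ]
      have hi : ∀ j ∈ (Finset.univ : Finset (Fin 3)), Integrable (fun e : (X × Y) × H =>
          (bpt γ j.succ - bpt γ j.castSucc) * splitLoss predict γ j.succ h e.1 e.2)
          (D.prod π) := fun j _ => (integrable_splitLoss hpredict D π γ j.succ h).const_mul _
      rw [integral_add (integrable_const _) (integrable_finsetSum _ hi), integral_finsetSum _ hi]
      simp [integral_const_mul, meanSplit]
    linarith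
  have hi : ∀ j ∈ (Finset.univ : Finset (Fin 3)), Integrable (fun h =>
      (bpt γ j.succ - bpt γ j.castSucc) * meanSplit predict D π γ j.succ h) ρ := fun j _ =>
    (Integrable.of_mem_Icc 0 1 (measurable_meanSplit hpredict D π γ j.succ).aemeasurable
      (ae_of_all _ fun h => meanSplit_mem_Icc D π predict γ j.succ h)).const_mul _
  have hi' : Integrable (fun h => -γ + ∑ j : Fin 3, (bpt γ j.succ - bpt γ j.castSucc)
      * meanSplit predict D π γ j.succ h) ρ :=
    (integrable_const _).add (integrable_finsetSum _ hi)
  rw [integral_congr_ae (ae_of_all _ hpt), integral_add hi' (integrable_const _),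
    integral_add (integrable_const _) (integrable_finsetSum _ hi), integral_finsetSum _ hi]
  simp [integral_const_mul]

/-- If `γ > 0`, an excess loss of at least `1` forces the reference rule to be correct. -/
theorem integral_meanSplit_add_integral_risk_le {γ : ℝ} (hγ : 0 < γ) (ρ : Measure H)
    [IsProbabilityMeasure ρ] :
    ∫ h, meanSplit predict D π γ 3 h ∂ρ + ∫ h, risk predict D h ∂π ≤ 1 := by
  obtain ⟨hi2, he2⟩ := integral_prod_loss_right hpredict D π
  have hpt : ∀ h, meanSplit predict D π γ 3 h ≤ 1 - ∫ h, risk predict D h ∂π := by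
    intro h
    have h1 : ∫ e : (X × Y) × H, (1 - loss predict e.2 e.1) ∂(D.prod π)
        = 1 - ∫ h, risk predict D h ∂π := by
      rw [integral_sub (integrable_const _) hi2, he2]; simp
    rw [← h1]
    refine integral_mono (integrable_splitLoss hpredict D π γ 3 h)
      ((integrable_const _).sub hi2) fun e => ?_
    have e3 : bpt γ 3 = 1 := rfl
    simp only [splitLoss, e3]
    rcases loss_eq_zero_or_one predict h e.1 with ha | ha <;>
      rcases loss_eq_zero_or_one predict e.2 e.1 with hb | hb <;>
      simp only [ha, hb] <;> split_ifs <;> linarith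
  have hm : Integrable (meanSplit predict D π γ 3) ρ :=
    Integrable.of_mem_Icc 0 1 (measurable_meanSplit hpredict D π γ 3).aemeasurable
      (ae_of_all _ fun h => meanSplit_mem_Icc D π predict γ 3 h)
  have := integral_mono hm (integrable_const _) hpt
  simp only [integral_const, probReal_univ, one_smul] at this
  linarith

end Mean

end Losses

/-! ### The bounds for the single steps -/

section Steps

variable {X Y H Ω Θ : Type*} [MeasurableSpace X] [MeasurableSpace Y] [MeasurableSpace H]
  [MeasurableSpace Ω] {mΘ : MeasurableSpace Θ}

/-- The PAC-Bayes-kl inequality for the zero-one loss on the whole sample. The prior is a function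
of some information `θ ω` that is independent of the sample. -/
theorem pacBayes_kl_empRisk (μ : Measure Ω) [IsProbabilityMeasure μ] {predict : H → X → Y}
    (hpredict : MeasurableSet {p : H × X × Y | predict p.1 p.2.1 ≠ p.2.2})
    (D : Measure (X × Y)) [IsProbabilityMeasure D] {n : ℕ} (hn : n ≠ 0) {S : Fin n → Ω → X × Y}
    (hS : ∀ i, Measurable (S i)) {θ : Ω → Θ} (hθ : Measurable θ) {π : Θ → Measure H}
    (hπ : Measurable π) (hπprob : ∀ θ, IsProbabilityMeasure (π θ))
    (hlaw : ∀ A : Set Θ, MeasurableSet A → ∀ P : Fin n → Set (X × Y),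
      (∀ i, MeasurableSet (P i)) →
      μ (θ ⁻¹' A ∩ {ω | ∀ i, S i ω ∈ P i}) = μ (θ ⁻¹' A) * ∏ i, D (P i))
    {c : ℝ} (hc : 0 < c) :
    μ {ω | ∃ ρ : Measure H, IsProbabilityMeasure ρ ∧ InformationTheory.klDiv ρ (π (θ ω)) ≠ ∞ ∧
        (InformationTheory.klDiv ρ (π (θ ω))
            + ENNReal.ofReal (Real.log (2 * √n / c))) / (n : ℝ≥0∞)
          ≤ kl (∫ h, empRisk predict (fun i => S i ω) h ∂ρ) (∫ h, risk predict D h ∂ρ)}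
      ≤ ENNReal.ofReal c := by
  have : Nonempty (Fin n) := ⟨⟨0, Nat.pos_of_ne_zero hn⟩⟩
  set πK : Kernel Θ H := ⟨π, hπ⟩ with hπK
  have : IsMarkovKernel πK := ⟨hπprob⟩
  have hℓ : Measurable fun x : (Θ × H) × (X × Y) => loss predict x.1.2 x.2 :=
    (measurable_loss hpredict).comp (measurable_fst.snd.prodMk measurable_snd)
  have h := pacBayes_kl μ hθ hS (Kernel.const Θ D) πK MeasurableSpace.isPiSystem_measurableSet
    MeasurableSpace.generateFrom_measurableSet.symm
    (MeasurableSet.univ : MeasurableSet (univ : Set (X × Y)))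
    (fun A hA B hB => by
      rw [hlaw A hA B hB]
      simp [mul_comm])
    (ℓ := fun _ h e => loss predict h e) hℓ (fun _ _ _ => loss_eq_zero_or_one ..) hc
  simp only [Fintype.card_fin] at h
  exact h

/-- The PAC-Bayes-kl inequality for the binary components of the excess loss on the validation
set. Each observation is a pair of a data point and a rule drawn from the prior. -/
theorem pacBayes_kl_empSplit (μ : Measure Ω) [IsProbabilityMeasure μ] {predict : H → X → Y}
    (hpredict : MeasurableSet {p : H × X × Y | predict p.1 p.2.1 ≠ p.2.2})
    (D : Measure (X × Y)) [IsProbabilityMeasure D] {n : ℕ} (chunk : Fin n → ℕ) {t : ℕ}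
    (hne : (valIdx chunk t).Nonempty) {S : Fin n → Ω → X × Y} (hS : ∀ i, Measurable (S i))
    {g : Fin n → Ω → H} (hg : ∀ i, Measurable (g i)) {θ : Ω → Θ} (hθ : Measurable θ)
    {π : Θ → Measure H} (hπ : Measurable π) (hπprob : ∀ θ, IsProbabilityMeasure (π θ))
    {γ : Θ → ℝ} (hγ : Measurable γ)
    (hlaw : ∀ A : Set Θ, MeasurableSet A → ∀ P : Fin n → Set (X × Y),
      (∀ i, MeasurableSet (P i)) → ∀ Q : Fin n → Set H, (∀ i, MeasurableSet (Q i)) →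
      μ (θ ⁻¹' A ∩ {ω | ∀ i ∈ valIdx chunk t, S i ω ∈ P i ∧ g i ω ∈ Q i})
        = ∫⁻ ω in θ ⁻¹' A, ∏ i ∈ valIdx chunk t, D (P i) * π (θ ω) (Q i) ∂μ)
    (j : Fin 4) {c : ℝ} (hc : 0 < c) :
    μ {ω | ∃ ρ : Measure H, IsProbabilityMeasure ρ ∧ InformationTheory.klDiv ρ (π (θ ω)) ≠ ∞ ∧
        (InformationTheory.klDiv ρ (π (θ ω))
            + ENNReal.ofReal (Real.log (2 * √(nVal chunk t : ℝ) / c))) / (nVal chunk t : ℝ≥0∞)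
          ≤ kl (∫ h, empSplit predict chunk (fun i => S i ω) (fun i => g i ω) t (γ (θ ω)) j h ∂ρ)
            (∫ h, meanSplit predict D (π (θ ω)) (γ (θ ω)) j h ∂ρ)}
      ≤ ENNReal.ofReal c := by
  classical
  set I := valIdx chunk t with hI
  have : Nonempty I := hne.to_subtype
  set πK : Kernel Θ H := ⟨π, hπ⟩ with hπK
  have : IsMarkovKernel πK := ⟨hπprob⟩
  set κ : Kernel Θ ((X × Y) × H) := (Kernel.const Θ D).prod πK with hκ
  have hκapp : ∀ θ, κ θ = D.prod (π θ) := fun θ => by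
    rw [hκ, Kernel.prod_apply]; rfl
  have hℓ : Measurable fun x : (Θ × H) × (X × Y) × H =>
      splitLoss predict (γ x.1.1) j x.1.2 x.2.1 x.2.2 :=
    (measurable_splitLoss hpredict j).comp
      (((hγ.comp measurable_fst.fst).prodMk measurable_fst.snd).prodMk measurable_snd)
  have h := pacBayes_kl μ hθ (ι := I) (W := fun i ω => (S i ω, g i ω))
    (fun i => (hS i).prodMk (hg i)) κ πK
    (C := image2 (· ×ˢ ·) {s : Set (X × Y) | MeasurableSet s} {s : Set H | MeasurableSet s})
    isPiSystem_prod generateFrom_prod.symm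
    ⟨univ, (MeasurableSet.univ : MeasurableSet (univ : Set (X × Y))), univ,
      (MeasurableSet.univ : MeasurableSet (univ : Set H)), univ_prod_univ⟩
    (fun A hA B hB => by
      choose P hP Q hQ hPQ using hB
      set P' : Fin n → Set (X × Y) := fun i => if h : i ∈ I then P ⟨i, h⟩ else univ with hP'
      set Q' : Fin n → Set H := fun i => if h : i ∈ I then Q ⟨i, h⟩ else univ with hQ'
      have hPe : ∀ i : I, P' i = P i := fun i => by simp [hP']
      have hQe : ∀ i : I, Q' i = Q i := fun i => by simp [hQ']
      have hl := hlaw A hA P'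
        (fun i => by by_cases h : i ∈ I <;> simp only [hP', h, dite_true, dite_false]
                     exacts [hP _, MeasurableSet.univ]) Q'
        (fun i => by by_cases h : i ∈ I <;> simp only [hQ', h, dite_true, dite_false]
                     exacts [hQ _, MeasurableSet.univ])
      have hset : {ω | ∀ i : I, (S i ω, g i ω) ∈ B i}
          = {ω | ∀ i ∈ I, S i ω ∈ P' i ∧ g i ω ∈ Q' i} := by
        ext ω
        simp only [mem_ofPred_eq, ← hPQ, mem_prod]
        refine ⟨fun h i hi => ?_, fun h i => ?_⟩
        · have := h ⟨i, hi⟩; rwa [← hPe, ← hQe] at this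
        · have := h i i.2; rwa [hPe, hQe] at this
      rw [hset, hl]
      refine lintegral_congr fun ω => ?_
      rw [← Finset.prod_coe_sort]
      refine Finset.prod_congr rfl fun i _ => ?_
      rw [← hPQ, hκapp, Measure.prod_prod, hPe, hQe])
    (ℓ := fun θ h e => splitLoss predict (γ θ) j h e.1 e.2) hℓ
    (fun _ _ _ => splitLoss_eq_zero_or_one ..) hc
  simp only [Fintype.card_coe, hκapp] at h
  refine (measure_mono ?_).trans h
  rintro ω ⟨ρ, hρ, hkl, hle⟩
  refine ⟨ρ, hρ, hkl, hle.trans (le_of_eq ?_)⟩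
  congr 1
  refine integral_congr_ae (ae_of_all _ fun h => ?_)
  simp only [empSplit, nVal, ← hI]
  rw [← Finset.sum_coe_sort I]

end Steps

/-- The joint law of the points and of the rules with indices in `I`, given the information `m`
from which the distribution of the rules was constructed. -/
theorem CondIIDFrom.measure_inter_box {X Y H Ω : Type*} [MeasurableSpace X] [MeasurableSpace Y]
    [MeasurableSpace H] {m mF mΩ : MeasurableSpace Ω} {μ : Measure Ω} {n : ℕ}
    {S : Fin n → Ω → X × Y} (hS : ∀ i, Measurable (S i)) (hSindep : iIndepFun S μ)
    {D : Measure (X × Y)} (hSlaw : ∀ i, μ.map (S i) = D) {π : Ω → Measure H} {g : Fin n → Ω → H}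
    (hcond : CondIIDFrom μ mF π g) (hπprob : ∀ ω, IsProbabilityMeasure (π ω))
    (hF : mF ≤ mΩ) (hmF : m ≤ mF)
    (hπ : Measurable[m] π) (I : Finset (Fin n)) (hdF : dataInfo S (· ∈ I) ≤ mF)
    (hind : Indep (dataInfo S (· ∈ I)) m μ) {A : Set Ω} (hA : MeasurableSet[m] A)
    {P : Fin n → Set (X × Y)} (hP : ∀ i, MeasurableSet (P i)) {Q : Fin n → Set H}
    (hQ : ∀ i, MeasurableSet (Q i)) :
    μ (A ∩ {ω | ∀ i ∈ I, S i ω ∈ P i ∧ g i ω ∈ Q i})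
      = ∫⁻ ω in A, ∏ i ∈ I, D (P i) * π ω (Q i) ∂μ := by
  classical
  -- The rules with indices outside `I` are left unconstrained.
  set Q' : Fin n → Set H := fun i => if i ∈ I then Q i else univ with hQ'
  have hQm : ∀ i, MeasurableSet (Q' i) := fun i => by
    by_cases h : i ∈ I <;> simp only [hQ', h, if_true, if_false]
    exacts [hQ i, MeasurableSet.univ]
  have hV := measurableSet_dataInfo_box (S := S) (I := I) hP
  have hset : A ∩ {ω | ∀ i ∈ I, S i ω ∈ P i ∧ g i ω ∈ Q i}
      = (A ∩ {ω | ∀ i ∈ I, S i ω ∈ P i}) ∩ {ω | ∀ i, g i ω ∈ Q' i} := by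
    ext ω
    have : (∀ i, g i ω ∈ Q' i) ↔ ∀ i ∈ I, g i ω ∈ Q i := by
      refine forall_congr' fun i => ?_
      by_cases h : i ∈ I <;> simp [hQ', h]
    simp only [mem_inter_iff, mem_ofPred_eq, this, and_assoc, ← forall_and]
  have hprod : ∀ ω, ∏ i, π ω (Q' i) = ∏ i ∈ I, π ω (Q i) := fun ω => by
    rw [← Finset.prod_subset (Finset.subset_univ I) fun i _ hi => by
      simp [hQ', hi, (hπprob ω).measure_univ]]
    exact Finset.prod_congr rfl fun i hi => by simp [hQ', hi]
  have hφ : Measurable[m] fun ω => ∏ i ∈ I, π ω (Q i) :=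
    Finset.measurable_prod _ fun i _ => (Measure.measurable_coe (hQ i)).comp hπ
  rw [hset, hcond _ ((hmF _ hA).inter (hdF _ hV)) Q' hQm]
  simp only [hprod]
  rw [setLIntegral_inter_of_indep (hdF.trans hF) (hmF.trans hF) hind hV hA hφ,
    measure_data_box hS hSindep hSlaw I hP,
    ← lintegral_const_mul _ (hφ.mono (hmF.trans hF) le_rfl)]
  simp only [Finset.prod_mul_distrib]

/-- Either the strict inequality `a < b`, or the equality `a = b = 1`. -/
def LtOrOne (a b : ℝ) : Prop := a < b ∨ a = 1 ∧ b = 1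

theorem LtOrOne.le {a b : ℝ} (h : LtOrOne a b) : a ≤ b := by
  rcases h with h | ⟨rfl, rfl⟩
  exacts [h.le, le_rfl]

/-- The recursive step. If `γ = 0`, only the second component matters. If `γ > 0`, equality would
require that the third component and the reference risk are both `1`, contradicting `h`. -/
theorem LtOrOne.recursion {γ R R' B' : ℝ} {F K : Fin 4 → ℝ} (hγ : γ ∈ Icc (0 : ℝ) 1)
    (hF : ∀ j : Fin 3, LtOrOne (F j.succ) (K j.succ)) (hR' : LtOrOne R' B')
    (h : 0 < γ → F 3 + R' ≤ 1)
    (hR : R = -γ + ∑ j : Fin 3, (bpt γ j.succ - bpt γ j.castSucc) * F j.succ + γ * R') :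
    LtOrOne R (-γ + ∑ j : Fin 3, (bpt γ j.succ - bpt γ j.castSucc) * K j.succ + γ * B') := by
  have e0 : bpt γ 0 = -γ := rfl
  have e1 : bpt γ 1 = 0 := rfl
  have e2 : bpt γ 2 = 1 - γ := rfl
  have e3 : bpt γ 3 = 1 := rfl
  have hF1 : LtOrOne (F 1) (K 1) := hF 0
  have hF2 : LtOrOne (F 2) (K 2) := hF 1
  have hF3 : LtOrOne (F 3) (K 3) := hF 2
  simp only [Fin.sum_univ_three, Fin.succ_zero_eq_one, Fin.succ_one_eq_two, Fin.castSucc_zero,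
    Fin.castSucc_one, show (2 : Fin 3).succ = 3 from rfl, show (2 : Fin 3).castSucc = 2 from rfl,
    e0, e1, e2, e3] at hR ⊢
  rcases hγ.1.eq_or_lt with rfl | hpos
  · convert! hF2 using 1
    · rw [hR]; ring
    · ring
  left
  have i1 := mul_le_mul_of_nonneg_left hF1.le hpos.le
  have i2 := mul_le_mul_of_nonneg_left hF2.le (by linarith [hγ.2] : 0 ≤ 1 - γ)
  have i3 := mul_le_mul_of_nonneg_left hF3.le hpos.le
  have i4 := mul_le_mul_of_nonneg_left hR'.le hpos.le
  rcases hF3 with h3 | ⟨h3, -⟩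
  · have := mul_lt_mul_of_pos_left h3 hpos
    rw [hR]; linarith
  rcases hR' with h4 | ⟨h4, -⟩
  · have := mul_lt_mul_of_pos_left h4 hpos
    rw [hR]; linarith
  linarith [h hpos]

/-- A bound on `kl` that holds when the divergence from the prior is finite yields the bound on the
mean, because the bound is `1` when this divergence is infinite. -/
theorem ltOrOne_klInvUpper {phat p : ℝ} (hp : p ∈ Icc (0 : ℝ) 1) {K a : ℝ≥0∞} {n : ℕ}
    (h : K ≠ ∞ → kl phat p < (K + a) / n) : LtOrOne p (klInvUpper phat ((K + a) / n)) := by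
  by_cases hK : K = ∞
  · rw [hK, top_add, ENNReal.top_div_of_ne_top (ENNReal.natCast_ne_top n), klInvUpper_top]
    exact hp.2.lt_or_eq.imp_right fun h => ⟨h, rfl⟩
  · exact lt_klInvUpper_or hp (h hK)

end RPB

theorem mainTheorem1
    {X Y H Ω : Type*} [MeasurableSpace X] [MeasurableSpace Y] [MeasurableSpace H]
    [MeasurableSpace Ω] (μ : Measure Ω) [IsProbabilityMeasure μ]
    (predict : H → X → Y)
    (hpredict : MeasurableSet {p : H × X × Y | predict p.1 p.2.1 ≠ p.2.2})
    (D : Measure (X × Y)) [IsProbabilityMeasure D]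
    -- the i.i.d. sample and its split into the subsamples `S_1, …, S_T`
    {n : ℕ} (S : Fin n → Ω → X × Y) (hS : ∀ i, Measurable (S i))
    (hSindep : iIndepFun S μ) (hSlaw : ∀ i, μ.map (S i) = D)
    (T : ℕ) (chunk : Fin n → ℕ) (hchunk : ∀ i, chunk i ∈ Finset.Icc 1 T)
    (hlast : ∃ i, chunk i = T)
    -- the distributions `π*_0, …, π*_T`, the rules sampled from them, and the coefficients
    (πs : ℕ → Ω → Measure H) (hs : ℕ → Fin n → Ω → H) (γ : ℕ → Ω → ℝ)
    (hhs : ∀ t i, Measurable (hs t i))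
    (hπprob : ∀ t ≤ T, ∀ ω, IsProbabilityMeasure (πs t ω))
    (hπ : ∀ t ≤ T, Measurable[RPB.trainInfo chunk S hs t] (πs t))
    (hsample : ∀ t, 1 ≤ t → t < T →
      RPB.CondIIDFrom μ (RPB.fullInfo S hs t) (πs t) (hs t))
    (hγ : ∀ t ∈ Finset.Icc 2 T, Measurable[RPB.trainInfo chunk S hs (t - 1)] (γ t))
    (hγ01 : ∀ t ∈ Finset.Icc 2 T, ∀ ω, γ t ω ∈ Icc (0 : ℝ) 1)
    -- the sets of posteriors, with no restriction on how they depend on the data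
    (Post : ℕ → Ω → Set (ProbabilityMeasure H))
    (δ : ℝ) (hδ : δ ∈ Ioo (0 : ℝ) 1) :
    μ {ω | ∃ t ∈ Finset.Icc 1 T, ∃ ρ ∈ Post t ω,
        RPB.bound predict T δ chunk (fun i => S i ω) (fun s i => hs s i ω) (fun s => γ s ω)
            (fun s => πs s ω) t (ρ : Measure H)
          ≤ ∫ h, RPB.risk predict D h ∂(ρ : Measure H) ∧
        ¬ (∫ h, RPB.risk predict D h ∂(ρ : Measure H) = 1 ∧
          RPB.bound predict T δ chunk (fun i => S i ω) (fun s i => hs s i ω) (fun s => γ s ω)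
            (fun s => πs s ω) t (ρ : Measure H) = 1)}
      ≤ ENNReal.ofReal δ := by
  open RPB in
  obtain ⟨i₀, hi₀⟩ := hlast
  have hT1 : 1 ≤ T := hi₀ ▸ (Finset.mem_Icc.1 (hchunk i₀)).1
  have hn : n ≠ 0 := fun h => (h ▸ i₀).elim0
  have hTR : (0 : ℝ) < T := by exact_mod_cast hT1
  have hδ0 := hδ.1
  have hmle : ∀ r, trainInfo chunk S hs r ≤ ‹MeasurableSpace Ω› := fun r =>
    (trainInfo_le_fullInfo chunk S hs r).trans (fullInfo_le hS hhs r)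
  have hind : ∀ r ≤ T,
      Indep (dataInfo S (· ∈ valIdx chunk (r + 1))) (trainInfo chunk S hs r) μ := fun r hr => by
    have h := indep_dataInfo_trainInfo hS hSindep chunk hhs hπ hsample hr
    have he : (fun i => i ∈ valIdx chunk (r + 1)) = (r < chunk ·) := by
      funext i; simp [valIdx]
    rwa [he]
  -- The level `δ / T` is spent on each of the `T` steps, divided among three components if `t ≥ 2`.
  set bad₁ : Set Ω := {ω | ∃ ρ : Measure H, IsProbabilityMeasure ρ ∧
    InformationTheory.klDiv ρ (πs 0 ω) ≠ ∞ ∧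
    (InformationTheory.klDiv ρ (πs 0 ω)
        + ENNReal.ofReal (Real.log (2 * T * √n / δ))) / (n : ℝ≥0∞)
      ≤ kl (∫ h, empRisk predict (fun i => S i ω) h ∂ρ) (∫ h, risk predict D h ∂ρ)} with hbad₁
  set bad : ℕ → Fin 3 → Set Ω := fun r j => {ω | ∃ ρ : Measure H, IsProbabilityMeasure ρ ∧
    InformationTheory.klDiv ρ (πs (r + 1) ω) ≠ ∞ ∧
    (InformationTheory.klDiv ρ (πs (r + 1) ω)
        + ENNReal.ofReal (Real.log (6 * T * √(nVal chunk (r + 2) : ℝ) / δ)))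
          / (nVal chunk (r + 2) : ℝ≥0∞)
      ≤ kl (∫ h, empSplit predict chunk (fun i => S i ω) (fun i => hs (r + 1) i ω) (r + 2)
          (γ (r + 2) ω) j.succ h ∂ρ)
        (∫ h, meanSplit predict D (πs (r + 1) ω) (γ (r + 2) ω) j.succ h ∂ρ)} with hbad
  have hμ₁ : μ bad₁ ≤ ENNReal.ofReal (δ / T) := by
    -- The validation set of the first step is the whole sample, and nothing is drawn before it.
    have hval : valIdx chunk (0 + 1) = Finset.univ :=
      Finset.filter_true_of_mem fun i _ => (Finset.mem_Icc.1 (hchunk i)).1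
    have h := pacBayes_kl_empRisk (mΘ := trainInfo chunk S hs 0) μ hpredict D hn hS (θ := id)
      (measurable_id'' (hmle 0)) (hπ 0 (Nat.zero_le T)) (hπprob 0 (Nat.zero_le T))
      (fun A hA P hP => by
        have hV := measurableSet_dataInfo_box (S := S) (I := valIdx chunk (0 + 1)) hP
        have h1 := (Indep_iff _ _ _).1 (hind 0 (Nat.zero_le T)) _ _ hV hA
        rw [measure_data_box hS hSindep hSlaw _ hP, hval] at h1
        rw [preimage_id, inter_comm, mul_comm, ← h1]
        simp) (c := δ / T) (by positivity)
    have hc : 2 * √(n : ℝ) / (δ / T) = 2 * T * √n / δ := by field_simp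
    rwa [hc] at h
  have hμ : ∀ r, r + 2 ≤ T → ∀ j, μ (bad r j) ≤ ENNReal.ofReal (δ / (3 * T)) := by
    intro r hr j
    have hmem : r + 2 ∈ Finset.Icc 2 T := Finset.mem_Icc.2 ⟨by omega, hr⟩
    have h := pacBayes_kl_empSplit (mΘ := trainInfo chunk S hs (r + 1)) μ hpredict D chunk
      (t := r + 2) ⟨i₀, by simp [valIdx, hi₀, hr]⟩ hS (hhs (r + 1)) (θ := id)
      (measurable_id'' (hmle _)) (hπ (r + 1) (by omega)) (hπprob (r + 1) (by omega))
      (hγ (r + 2) hmem)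
      (fun A hA P hP Q hQ => (hsample (r + 1) (by omega) (by omega)).measure_inter_box hS hSindep
        hSlaw (hπprob (r + 1) (by omega)) (fullInfo_le hS hhs _)
        (trainInfo_le_fullInfo chunk S hs _)
        (hπ (r + 1) (by omega)) _ ((iSup_mono fun _ => iSup_const_le).trans le_sup_left)
        (hind (r + 1) (by omega)) hA hP hQ)
      j.succ (c := δ / (3 * T)) (by positivity)
    have hc : 2 * √(nVal chunk (r + 2) : ℝ) / (δ / (3 * T))
        = 6 * T * √(nVal chunk (r + 2) : ℝ) / δ := by field_simp; ring
    rwa [hc] at h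
  have hsub : {ω | ∃ t ∈ Finset.Icc 1 T, ∃ ρ ∈ Post t ω,
        RPB.bound predict T δ chunk (fun i => S i ω) (fun s i => hs s i ω) (fun s => γ s ω)
            (fun s => πs s ω) t (ρ : Measure H)
          ≤ ∫ h, RPB.risk predict D h ∂(ρ : Measure H) ∧
        ¬ (∫ h, RPB.risk predict D h ∂(ρ : Measure H) = 1 ∧
          RPB.bound predict T δ chunk (fun i => S i ω) (fun s i => hs s i ω) (fun s => γ s ω)
            (fun s => πs s ω) t (ρ : Measure H) = 1)}
      ⊆ bad₁ ∪ ⋃ r ∈ Finset.range (T - 1), ⋃ j, bad r j := by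
    rintro ω ⟨t, ht, ρ, -, hle, hne⟩
    by_contra hω
    simp only [mem_union, mem_iUnion, Finset.mem_range, not_or, not_exists] at hω
    obtain ⟨hω₁, hω⟩ := hω
    have key : ∀ t, t + 1 ≤ T → ∀ ρ : Measure H, IsProbabilityMeasure ρ →
        LtOrOne (∫ h, risk predict D h ∂ρ)
          (bound predict T δ chunk (fun i => S i ω) (fun s i => hs s i ω) (fun s => γ s ω)
            (fun s => πs s ω) (t + 1) ρ) := by
      intro t
      induction t with
      | zero =>
        intro _ ρ hρ
        refine ltOrOne_klInvUpper (integral_mem_Icc ρ (risk_mem_Icc predict D)) fun hK => ?_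
        by_contra hlt
        exact hω₁ ⟨ρ, hρ, hK, not_lt.1 hlt⟩
      | succ r ih =>
        intro hr ρ hρ
        have hmem : r + 2 ∈ Finset.Icc 2 T := Finset.mem_Icc.2 ⟨by omega, hr⟩
        have hπp := hπprob (r + 1) (by omega) ω
        have hγω := hγ01 (r + 2) hmem ω
        refine LtOrOne.recursion
          (F := fun j => ∫ h, meanSplit predict D (πs (r + 1) ω) (γ (r + 2) ω) j h ∂ρ)
          (K := fun j => klInvUpper (∫ h, empSplit predict chunk (fun i => S i ω)
              (fun i => hs (r + 1) i ω) (r + 2) (γ (r + 2) ω) j h ∂ρ)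
            ((InformationTheory.klDiv ρ (πs (r + 1) ω)
              + ENNReal.ofReal (Real.log (6 * T * √(nVal chunk (r + 2) : ℝ) / δ)))
                / (nVal chunk (r + 2) : ℝ≥0∞)))
          hγω (fun j => ?_) (ih (by omega) _ hπp)
          (fun hpos => integral_meanSplit_add_integral_risk_le hpredict D _ hpos ρ)
          (integral_risk_eq hpredict D _ hγω ρ)
        refine ltOrOne_klInvUpper (integral_mem_Icc ρ fun h =>
          meanSplit_mem_Icc D _ predict _ _ h) fun hK => ?_
        by_contra hlt
        exact hω r (by omega) j ⟨ρ, hρ, hK, not_lt.1 hlt⟩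
    obtain ⟨ht1, htT⟩ := Finset.mem_Icc.1 ht
    obtain ⟨s, rfl⟩ := Nat.exists_eq_add_of_le' ht1
    rcases key s htT ρ inferInstance with h | h
    · exact absurd h (not_lt.2 hle)
    · exact hne h
  refine (measure_mono hsub).trans ?_
  calc _ ≤ μ bad₁ + ∑ r ∈ Finset.range (T - 1), ∑ j, μ (bad r j) := by
        refine (measure_union_le _ _).trans (add_le_add le_rfl ?_)
        refine (measure_biUnion_finset_le _ _).trans (Finset.sum_le_sum fun r _ => ?_)
        exact measure_iUnion_fintype_le _ _
    _ ≤ ENNReal.ofReal (δ / T)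
          + ∑ r ∈ Finset.range (T - 1), ∑ _j : Fin 3, ENNReal.ofReal (δ / (3 * T)) := by
        refine add_le_add hμ₁ (Finset.sum_le_sum fun r hr => Finset.sum_le_sum fun j _ => ?_)
        have := Finset.mem_range.1 hr
        exact hμ r (by omega) j
    _ = ENNReal.ofReal δ := by
        obtain ⟨s, rfl⟩ := Nat.exists_eq_add_of_le' hT1
        simp only [Finset.sum_const, Finset.card_univ, Fintype.card_fin, Finset.card_range,
          Nat.add_sub_cancel, nsmul_eq_mul]
        rw [← ENNReal.ofReal_natCast, ← ENNReal.ofReal_natCast, ← ENNReal.ofReal_mul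
          (by positivity), ← ENNReal.ofReal_mul (by positivity),
          ← ENNReal.ofReal_add (by positivity) (by positivity)]
        congr 1
        push_cast at hTR ⊢
        field_simp
        ring
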